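/- Let $d,q\ge 1$ be integers, $\mathbf H=(H_1,\dots,H_d)\in(\tfrac12,1)^d$, and let $W=(W(\mathbf t))_{\mathbf t\in\mathbb R^d}$ be a standard Brownian sheet on a probability space, i.e. a centered Gaussian process with covariance $\prod_{i}\tfrac12(|s_i|+|t_i|-|s_i-t_i|)$ (which is $\prod_i s_i\wedge t_i$ for $\mathbf s,\mathbf t\ge 0$). Let $I_q$ be the multiple Wiener–Itô integral of order $q$ with respect to $W$, with the usual normalization $E[I_q(g)^2]=q!\,\|g\|^2_{L^2}$ for symmetric $g\in L^2((\mathbb R^d)^q)$. For measurable $f:\mathbb R^d\to\mathbb R$ put $$J f(\mathbf y_1,\dots,\mathbf y_q)=c(\mathbf H,q)\int_{\mathbb R^d}f(\mathbf u)\prod_{j=1}^q\prod_{i=1}^d(u_i-y_{j,i})_+^{-\left(\frac12+\frac{1-H_i}{q}\right)}\,d\mathbf u,$$ $$c(\mathbf H,q)^2=\frac1{q!}\prod_{i=1}^d\frac{H_i(2H_i-1)}{\beta\left(\frac12-\frac{1-H_i}q,\frac{2(1-H_i)}q\right)^q},\qquad c(\mathbf H,q)>0 .$$ Here $x_+^{-a}=x^{-a}$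 for $x>0$ and $x_+^{-a}=0$ for $x\le 0$, and $\beta$ is the Beta function. The Hermite sheet is $Z^q_{\mathbf H}(\mathbf t)=I_q(J 1_{[\mathbf 0,\mathbf t]})$, $\mathbf t\in\mathbb R^d$, where $1_{[\mathbf 0,\mathbf t]}$ is taken with orientation: $\int 1_{[\mathbf 0,\mathbf t]}g=\int_0^{t_1}\cdots\int_0^{t_d}g$. For an elementary function $f=\sum_l a_l1_{(\mathbf s_l,\mathbf t_l]}$ (a finite sum over rectangles with $\mathbf s_l<\mathbf t_l$ coordinatewise) put $\int f\,dZ^q_{\mathbf H}=\sum_l a_l(\Delta Z^q_{\mathbf H})_{[\mathbf s_l,\mathbf t_l]}$, where $(\Delta X)_{[\mathbf s,\mathbf t]}=\sum_{\mathbf r\in\{0,1\}^d}(-1)^{d-\sum_i r_i}X(\mathbf s+\mathbf r(\mathbf t-\mathbf s))$, with $\mathbf r(\mathbf t-\mathbf s)$ the coordinatewise product. Let $\mathcal H$ be the space of measurable $f$ such that the integral defining $Jf(\mathbf y)$ converges absolutely for a.e. $\mathbf y$ and $Jf\in L^2((\mathbb R^d)^q)$, with $\|f\|_{\mathcal H}^2=q!\int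 (Jf)^2\,d\mathbf y$. Then: 1. Every elementary $f$ lies in $\mathcal H$, and $\int f\,dZ^q_{\mathbf H}\in L^2(\Omega)$ with $$E\Big[\Big(\int f\,dZ^q_{\mathbf H}\Big)^2\Big]=\|f\|^2_{\mathcal H}=\prod_{i=1}^dH_i(2H_i-1)\int_{\mathbb R^d}\int_{\mathbb R^d}f(\mathbf u)f(\mathbf v)\prod_{i=1}^d|u_i-v_i|^{2H_i-2}\,d\mathbf v\,d\mathbf u,$$ where the double integral converges absolutely; in particular the value does not depend on $q$. Moreover $\int f\,dZ^q_{\mathbf H}=I_q(Jf)$ almost surely. 2. The map $f\mapsto\int f\,dZ^q_{\mathbf H}$ extends from the elementary functions to a linear isometry $\Phi:\mathcal H\to L^2(\Omega)$, $E[\Phi(f)^2]=\|f\|_{\mathcal H}^2$, and $\Phi(f)=I_q(Jf)$ for all $f\in\mathcal H$. 3. If $f$ is measurable and $\int\int|f(\mathbf u)||f(\mathbf v)|\prod_i|u_i-v_i|^{2H_i-2}\,d\mathbf v\,d\mathbf u<\infty$, then $f\in\mathcal H$ and $\|f\|^2_{\mathcal H}$ is given by the double integral of part 1. -/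

import Mathlib

open MeasureTheory ProbabilityTheory Filter Topology

noncomputable section

namespace HermiteSheet

variable {d q : ℕ} {Ω : Type*} [MeasurableSpace Ω]

/-! ### Rectangles and rectangular increments -/

/-- A half-open rectangle `(s, t] = ∏ i, (s i, t i]` of `ℝ^d` with `s i < t i` for all `i`. -/
structure Rect (d : ℕ) where
  lower : Fin d → ℝ
  upper : Fin d → ℝ
  lower_lt_upper : ∀ i, lower i < upper i

/-- The set of points of the rectangle `(s, t]`. -/
def Rect.toSet (R : Rect d) : Set (Fin d → ℝ) :=
  {u | ∀ i, R.lower i < u i ∧ u i ≤ R.upper i}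

/-- The generalized increment over `[s, t]` of a function `x` on `ℝ^d`:
`∑_{r ∈ {0,1}^d} (-1)^(d - ∑ r_i) x (s + r (t - s))`. -/
def Rect.increment (R : Rect d) (x : (Fin d → ℝ) → ℝ) : ℝ :=
  ∑ r : Fin d → Fin 2, (-1 : ℝ) ^ (d - ∑ i, (r i : ℕ)) *
    x (fun i => R.lower i + ((r i : ℕ) : ℝ) * (R.upper i - R.lower i))

/-! ### The standard Brownian sheet and multiple Wiener–Itô integrals -/

/-- `W` is a standard Brownian sheet indexed by `ℝ^d`: a centered Gaussian process whose covariance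
is `∏ i, (|s i| + |t i| - |s i - t i|) / 2`. For `s, t ≥ 0` this is `∏ i, min (s i) (t i)`; the
factor is `min |s i| |t i|` if `s i` and `t i` have the same sign, and `0` otherwise. In particular
`W t = 0` almost surely as soon as some `t i = 0`. -/
structure IsBrownianSheet (W : (Fin d → ℝ) → Ω → ℝ) (P : Measure Ω) : Prop where
  isGaussianProcess : IsGaussianProcess W P
  integral_eq_zero : ∀ t, ∫ ω, W t ω ∂P = 0
  covariance_eq : ∀ s t, ∫ ω, W s ω * W t ω ∂P = ∏ i, (|s i| + |t i| - |s i - t i|) / 2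

open Classical in
/-- The class in `L²(μ)` of a square integrable function (and `0` for any other function). -/
def toL2 {α : Type*} [MeasurableSpace α] (μ : Measure α) (g : α → ℝ) : Lp ℝ 2 μ :=
  if h : MemLp g 2 μ then h.toLp g else 0

/-- A `q`-tuple of pairwise disjoint rectangles of `ℝ^d`. The product of these rectangles does not
meet the diagonals `{y | y j = y k}`, `j ≠ k`, of `(ℝ^d)^q`. -/
structure DisjointRects (d q : ℕ) where
  rect : Fin q → Rect d
  disjoint : ∀ j k, j ≠ k → Disjoint (rect j).toSet (rect k).toSet

/-- The elementary kernel `∑ a_k 1_{A_{k,1} × ⋯ × A_{k,q}}` on `(ℝ^d)^q`, vanishing on the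
diagonals. -/
def elemKernel (e : DisjointRects d q →₀ ℝ) (y : Fin q → Fin d → ℝ) : ℝ :=
  e.sum fun A a => a * ∏ j, (A.rect j).toSet.indicator (fun _ => (1 : ℝ)) (y j)

/-- The multiple integral `∑ a_k W(A_{k,1}) ⋯ W(A_{k,q})` of an elementary kernel. -/
def elemMultipleIntegral (W : (Fin d → ℝ) → Ω → ℝ) (e : DisjointRects d q →₀ ℝ) (ω : Ω) : ℝ :=
  e.sum fun A a => a * ∏ j, (A.rect j).increment (fun t => W t ω)

/-- The multiple Wiener–Itô integral `I_q(g) = ∫ g dW(y_1) ⋯ dW(y_q)` of `g ∈ L²((ℝ^d)^q)`: the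
limit in `L²(Ω)` of the multiple integrals of elementary kernels, as the elementary kernels tend
to `g` in `L²((ℝ^d)^q)`. No factor is inserted: `E[I_q(g)²] = q! ‖g‖²` for symmetric `g`. -/
def multipleIntegral (W : (Fin d → ℝ) → Ω → ℝ) (P : Measure Ω)
    (g : (Fin q → Fin d → ℝ) → ℝ) : Lp ℝ 2 P :=
  limUnder
    (comap (fun e : DisjointRects d q →₀ ℝ => toL2 volume (elemKernel e)) (𝓝 (toL2 volume g)))
    (fun e : DisjointRects d q →₀ ℝ => toL2 P (elemMultipleIntegral W e))

/-! ### The Hermite sheet -/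

/-- The Beta function `β(a, b) = ∫₀¹ z^(a-1) (1-z)^(b-1) dz`. -/
def betaFn (a b : ℝ) : ℝ :=
  ∫ z in (0 : ℝ)..1, z ^ (a - 1) * (1 - z) ^ (b - 1)

/-- The normalization constant
`c(H,q) = ((1/q!) ∏ i, H_i (2 H_i - 1) / β(1/2 - (1-H_i)/q, 2(1-H_i)/q)^q)^(1/2)`. -/
def hermiteConst (H : Fin d → ℝ) (q : ℕ) : ℝ :=
  Real.sqrt ((1 / (q.factorial : ℝ)) *
    ∏ i, H i * (2 * H i - 1) / betaFn (1 / 2 - (1 - H i) / q) (2 * (1 - H i) / q) ^ q)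

/-- `∏ j, ∏ i, (u_i - y_{j,i})_+ ^ (-(1/2 + (1 - H_i)/q))`. The exponents are negative and
`0 ^ r = 0` for real `r ≠ 0`, so that this vanishes unless all `u_i - y_{j,i}` are positive. -/
def hermiteKernel (H : Fin d → ℝ) (q : ℕ) (u : Fin d → ℝ) (y : Fin q → Fin d → ℝ) : ℝ :=
  ∏ j, ∏ i, (max (u i - y j i) 0) ^ (-(1 / 2 + (1 - H i) / q) : ℝ)

/-- The operator `J f (y_1, …, y_q) = c(H,q) ∫ f(u) ∏ j, (u - y_j)_+ ^ (-(1/2 + (1-H)/q)) du`. -/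
def J (H : Fin d → ℝ) (q : ℕ) (f : (Fin d → ℝ) → ℝ) (y : Fin q → Fin d → ℝ) : ℝ :=
  hermiteConst H q * ∫ u, f u * hermiteKernel H q u y

/-- The oriented indicator of the rectangle with corners `0` and `t`, that is, the function whose
integral against `g` is `∫_0^{t_1} ⋯ ∫_0^{t_d} g`. For `t ≥ 0` it is the indicator of `(0, t]`. -/
def orientedIndicator (t u : Fin d → ℝ) : ℝ :=
  ∏ i, ((Set.Ioc 0 (t i)).indicator (fun _ => (1 : ℝ)) (u i) -
    (Set.Ioc (t i) 0).indicator (fun _ => (1 : ℝ)) (u i))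

/-- `Z` is (a version of) the Hermite sheet of order `q` and Hurst multi-index `H` driven by `W`:
`Z(t) = c(H,q) ∫_{(ℝ^d)^q} ∫_0^t ∏ j, (s - y_j)_+ ^ (-(1/2 + (1-H)/q)) ds dW(y_1) ⋯ dW(y_q)`. -/
def IsHermiteSheet (H : Fin d → ℝ) (q : ℕ) (W : (Fin d → ℝ) → Ω → ℝ) (P : Measure Ω)
    (Z : (Fin d → ℝ) → Ω → ℝ) : Prop :=
  ∀ t, Z t =ᵐ[P] multipleIntegral W P (J H q (orientedIndicator t))

/-! ### Elementary functions and their Wiener integrals -/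

/-- The elementary function `∑ a_l 1_{(s_l, t_l]}` on `ℝ^d`. -/
def elemFun (e : Rect d →₀ ℝ) (u : Fin d → ℝ) : ℝ :=
  e.sum fun R a => a * R.toSet.indicator (fun _ => (1 : ℝ)) u

/-- The Wiener integral `∑ a_l (ΔZ)_{[s_l, t_l]}` of the elementary function `∑ a_l 1_{(s_l, t_l]}`
against `Z`. -/
def elemIntegral (Z : (Fin d → ℝ) → Ω → ℝ) (e : Rect d →₀ ℝ) (ω : Ω) : ℝ :=
  e.sum fun R a => a * R.increment (fun t => Z t ω)

/-! ### The space of integrands -/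

/-- The space `ℋ` of the (measurable) functions `f` on `ℝ^d` for which the integral defining
`J f (y)` converges for almost every `y` and `J f ∈ L²((ℝ^d)^q)`. -/
def hSpace (H : Fin d → ℝ) (q : ℕ) : Submodule ℝ ((Fin d → ℝ) → ℝ) where
  carrier := {f | AEStronglyMeasurable f volume ∧
    (∀ᵐ y : Fin q → Fin d → ℝ, Integrable (fun u => f u * hermiteKernel H q u y)) ∧
    MemLp (J H q f) 2 volume}
  zero_mem' := by
    refine ⟨aestronglyMeasurable_const, ?_, ?_⟩
    · simp
    · have : J H q (0 : (Fin d → ℝ) → ℝ) = 0 := by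
        funext y
        simp [J]
      rw [this]
      exact MemLp.zero
  add_mem' := by
    rintro f g ⟨hf, hf', hf''⟩ ⟨hg, hg', hg''⟩
    refine ⟨hf.add hg, ?_, ?_⟩
    · filter_upwards [hf', hg'] with y h1 h2
      refine (h1.add h2).congr (ae_of_all _ fun u => ?_)
      simp [add_mul]
    · refine (hf''.add hg'').ae_eq ?_
      filter_upwards [hf', hg'] with y h1 h2
      simp only [J, Pi.add_apply, add_mul]
      rw [integral_add h1 h2, mul_add]
  smul_mem' := by
    rintro c f ⟨hf, hf', hf''⟩
    refine ⟨hf.const_smul c, ?_, ?_⟩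
    · filter_upwards [hf'] with y h1
      simpa [mul_assoc] using h1.const_mul c
    · have : J H q (c • f) = c • J H q f := by
        funext y
        simp only [J, Pi.smul_apply, smul_eq_mul, mul_assoc]
        rw [integral_const_mul]
        ring
      rw [this]
      exact hf''.const_smul c

/-- `‖f‖²_ℋ = q! ∫ (J f)² dy_1 ⋯ dy_q`. -/
def hNormSq (H : Fin d → ℝ) (q : ℕ) (f : (Fin d → ℝ) → ℝ) : ℝ :=
  (q.factorial : ℝ) * ∫ y : Fin q → Fin d → ℝ, J H q f y ^ 2

/-- `|u - v|^(2H - 2) = ∏ i, |u_i - v_i| ^ (2 H_i - 2)`. -/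
def rieszKernel (H : Fin d → ℝ) (u v : Fin d → ℝ) : ℝ :=
  ∏ i, |u i - v i| ^ (2 * H i - 2)

/-- `H(2H-1) ∫∫ f(u) f(v) |u - v|^(2H-2) du dv`, where `H(2H-1) = ∏ i, H_i (2 H_i - 1)`. -/
def doubleIntegral (H : Fin d → ℝ) (f : (Fin d → ℝ) → ℝ) : ℝ :=
  (∏ i, H i * (2 * H i - 1)) * ∫ u, ∫ v, f u * f v * rieszKernel H u v

end HermiteSheet

end

noncomputable section

namespace HermiteSheet

section

/-! ### The Beta integral and the one-dimensional kernel -/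

/-! Two independent facts carry the proof.

The first is deterministic. The kernel of `J` is a product over the variables `j` and the
coordinates `i`, so its correlation `∫ K(u, y) K(v, y) dy` is a product of one-dimensional
integrals. With `a = 1/2 + (1 - H)/q`, each of these equals `β(1 - a, 2a - 1) |u - v|^(1 - 2a)`.
Since `q (1 - 2a) = 2H - 2`, the `q`-th power gives the Riesz kernel (`integral_hermiteKernel_mul`).
Fubini then turns `∫ (J f)²` into the double integral whenever the latter converges absolutely
(`mem_hSpace_of_integrable`), and `c(H, q)` is chosen so that `q` cancels. Bounded functions with
bounded support qualify because `2H - 2 > -1`.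

The second is the Itô isometry. Increments of `W` over rectangles are centered jointly Gaussian with
covariance the volume of the intersection. A Wick formula for `∏ X_j ∏ Y_k` with orthogonal `X_j`
(`integral_prod_mul_prod`) gives `E[I(e)²] = ∑ σ, ⟨e ∘ σ, e⟩` for elementary kernels `e`. This is at
most `q! ‖e‖²`, and the elementary kernels are dense because the diagonals are null sets. Hence
`I_q` is a continuous linear map on `L²`, with `‖I_q g‖² = q! ‖g‖²` for symmetric `g`.

As `J f` is symmetric, `Φ = I_q ∘ J` is an isometry, defined at once on all of `ℋ`. It agrees with
the elementary integral because the indicator of a rectangle is the increment of `t ↦ 1_{[0,t]}`,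
and `Φ` is linear. -/

theorem integrableOn_beta {a b : ℝ} (ha : 0 < a) (hb : 0 < b) :
    IntegrableOn (fun z : ℝ => z ^ (a - 1) * (1 - z) ^ (b - 1)) (Set.Ioc 0 1) := by
  have h := Complex.betaIntegral_convergent (u := a) (v := b) (by simpa) (by simpa)
  rw [intervalIntegrable_iff_integrableOn_Ioc_of_le zero_le_one] at h
  refine IntegrableOn.congr_fun h.re (fun x hx => ?_) measurableSet_Ioc
  have h1 : (x : ℂ) ^ ((a : ℂ) - 1) = ((x ^ (a - 1) : ℝ) : ℂ) := by
    rw [Complex.ofReal_cpow hx.1.le]; push_cast; rfl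
  have h2 : (1 - (x : ℂ)) ^ ((b : ℂ) - 1) = (((1 - x) ^ (b - 1) : ℝ) : ℂ) := by
    rw [Complex.ofReal_cpow (by linarith [hx.2])]; push_cast; rfl
  simp only [h1, h2]
  rw [← Complex.ofReal_mul]
  exact RCLike.ofReal_re _

theorem betaFn_pos {a b : ℝ} (ha : 0 < a) (hb : 0 < b) : 0 < betaFn a b := by
  refine intervalIntegral.intervalIntegral_pos_of_pos_on ?_ (fun x hx => ?_) one_pos
  · rw [intervalIntegrable_iff_integrableOn_Ioc_of_le zero_le_one]
    exact integrableOn_beta ha hb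
  · exact mul_pos (Real.rpow_pos_of_pos hx.1 _) (Real.rpow_pos_of_pos (by linarith [hx.2]) _)

/-- The substitution for the correlation integral. With `h = v - u` and `y = u - h z/(1 - z)` one
has `u - y = h z/(1 - z)` and `v - y = h/(1 - z)`, so products of powers become a Beta integrand. -/
theorem image_sub_mul_div (u : ℝ) {h : ℝ} (hh : 0 < h) :
    (fun z : ℝ => u - h * (z / (1 - z))) '' Set.Ioo 0 1 = Set.Iio u := by
  ext y
  constructor
  · rintro ⟨z, hz, rfl⟩
    have : 0 < h * (z / (1 - z)) := mul_pos hh (div_pos hz.1 (by linarith [hz.2]))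
    simpa using this
  · intro hy
    have hy' : 0 < u - y := sub_pos.2 hy
    refine ⟨(u - y) / (h + (u - y)), ⟨by positivity, (div_lt_one (by positivity)).2 (by linarith)⟩,
      ?_⟩
    have h2 : h + (u - y) ≠ 0 := by positivity
    have h1 : (1 : ℝ) - (u - y) / (h + (u - y)) = h / (h + (u - y)) := by
      field_simp; ring
    simp only [h1]
    field_simp
    ring

theorem hasDerivAt_sub_mul_div (u h : ℝ) {z : ℝ} (hz : z < 1) :
    HasDerivAt (fun z : ℝ => u - h * (z / (1 - z))) (-(h / (1 - z) ^ 2)) z := by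
  have h1 : (1 - z) ≠ 0 := by linarith
  have := (((hasDerivAt_id z).div ((hasDerivAt_id z).const_sub 1) h1).const_mul h).const_sub u
  refine this.congr_deriv ?_
  simp only [id]
  field_simp
  ring

theorem injOn_sub_mul_div (u : ℝ) {h : ℝ} (hh : 0 < h) :
    Set.InjOn (fun z : ℝ => u - h * (z / (1 - z))) (Set.Ioo 0 1) := by
  intro x hx y hy hxy
  have hx' : 1 - x ≠ 0 := by linarith [hx.2]
  have hy' : 1 - y ≠ 0 := by linarith [hy.2]
  have : x / (1 - x) = y / (1 - y) := by
    have := sub_right_injective hxy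
    exact mul_left_cancel₀ hh.ne' this
  rw [div_eq_div_iff hx' hy'] at this
  linarith

theorem abs_deriv_smul_kernel {a u v : ℝ} (huv : u < v) {z : ℝ} (hz : z ∈ Set.Ioo (0 : ℝ) 1) :
    |-((v - u) / (1 - z) ^ 2)| • ((max (u - (u - (v - u) * (z / (1 - z)))) 0) ^ (-a) *
      (max (v - (u - (v - u) * (z / (1 - z)))) 0) ^ (-a)) =
    (v - u) ^ (1 - 2 * a) * (z ^ ((1 - a) - 1) * (1 - z) ^ ((2 * a - 1) - 1)) := by
  have hh : 0 < v - u := sub_pos.2 huv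
  have h1 : 0 < 1 - z := by linarith [hz.2]
  have h0 : 0 < z := hz.1
  have e1 : u - (u - (v - u) * (z / (1 - z))) = (v - u) * z * (1 - z)⁻¹ := by
    rw [div_eq_mul_inv]; ring
  have e2 : v - (u - (v - u) * (z / (1 - z))) = (v - u) * (1 - z)⁻¹ := by
    field_simp; ring
  rw [e1, e2, max_eq_left (by positivity), max_eq_left (by positivity), abs_neg,
    abs_of_pos (by positivity), smul_eq_mul, Real.mul_rpow (by positivity) (by positivity),
    Real.mul_rpow hh.le h0.le, Real.mul_rpow hh.le (by positivity), Real.inv_rpow h1.le,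
    ← Real.rpow_neg h1.le, neg_neg, show (1 - a) - 1 = -a by ring]
  have e3 : (v - u) ^ (1 - 2 * a) = (v - u) * (v - u) ^ (-a) * (v - u) ^ (-a) := by
    rw [show 1 - 2 * a = 1 + -a + -a by ring, Real.rpow_add hh, Real.rpow_add hh, Real.rpow_one]
  have e4 : (1 - z) ^ (2 * a - 1 - 1) = (1 - z) ^ a * (1 - z) ^ a / (1 - z) ^ 2 := by
    rw [show 2 * a - 1 - 1 = a + a - (2 : ℕ) by push_cast; ring, Real.rpow_sub h1, Real.rpow_add h1,
      Real.rpow_natCast]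
  rw [e3, e4]
  field_simp

/-- The condition `a < 1` controls the singularity at `y = u` (`z = 0`), and `1/2 < a` the decay as
`y → -∞` (`z = 1`). -/
theorem kernel_one_aux {a u v : ℝ} (ha : 1 / 2 < a) (ha' : a < 1) (huv : u < v) :
    Integrable (fun y => (max (u - y) 0) ^ (-a) * (max (v - y) 0) ^ (-a)) ∧
    ∫ y, (max (u - y) 0) ^ (-a) * (max (v - y) 0) ^ (-a) =
      betaFn (1 - a) (2 * a - 1) * (v - u) ^ (1 - 2 * a) := by
  have hh : 0 < v - u := sub_pos.2 huv
  have hb := integrableOn_beta (a := 1 - a) (b := 2 * a - 1) (by linarith) (by linarith)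
  rw [integrableOn_Ioc_iff_integrableOn_Ioo] at hb
  set g : ℝ → ℝ := fun y => (max (u - y) 0) ^ (-a) * (max (v - y) 0) ^ (-a) with hg
  have hsupp : (Set.Iio u).indicator g = g := by
    -- For `y ≥ u` the first factor is `0 ^ (-a)`, which is `0` because `a ≠ 0`.
    refine Set.indicator_eq_self.2 fun y hy => ?_
    by_contra hy'
    refine hy ?_
    have : max (u - y) 0 = 0 := max_eq_right (by simpa using hy')
    simp [hg, this, Real.zero_rpow (by linarith : -a ≠ 0)]
  have hd : ∀ z ∈ Set.Ioo (0 : ℝ) 1, HasDerivWithinAt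
      (fun z : ℝ => u - (v - u) * (z / (1 - z))) (-((v - u) / (1 - z) ^ 2)) (Set.Ioo 0 1) z :=
    fun z hz => (hasDerivAt_sub_mul_div u (v - u) hz.2).hasDerivWithinAt
  constructor
  · rw [← hsupp, integrable_indicator_iff measurableSet_Iio, ← image_sub_mul_div u hh,
      integrableOn_image_iff_integrableOn_abs_deriv_smul measurableSet_Ioo hd
        (injOn_sub_mul_div u hh)]
    exact IntegrableOn.congr_fun (hb.const_mul ((v - u) ^ (1 - 2 * a)))
      (fun z hz => (abs_deriv_smul_kernel huv hz).symm) measurableSet_Ioo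
  · rw [← hsupp, integral_indicator measurableSet_Iio, ← image_sub_mul_div u hh,
      integral_image_eq_integral_abs_deriv_smul measurableSet_Ioo hd (injOn_sub_mul_div u hh),
      setIntegral_congr_fun measurableSet_Ioo (fun z hz => abs_deriv_smul_kernel huv hz),
      integral_const_mul, betaFn, intervalIntegral.integral_of_le zero_le_one,
      integral_Ioc_eq_integral_Ioo, mul_comm]

theorem kernel_one {a u v : ℝ} (ha : 1 / 2 < a) (ha' : a < 1) (huv : u ≠ v) :
    Integrable (fun y => (max (u - y) 0) ^ (-a) * (max (v - y) 0) ^ (-a)) ∧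
    ∫ y, (max (u - y) 0) ^ (-a) * (max (v - y) 0) ^ (-a) =
      betaFn (1 - a) (2 * a - 1) * |u - v| ^ (1 - 2 * a) := by
  rcases huv.lt_or_gt with h | h
  · rw [abs_sub_comm, abs_of_pos (sub_pos.2 h)]
    exact kernel_one_aux ha ha' h
  · rw [abs_of_pos (sub_pos.2 h)]
    simp_rw [mul_comm ((max (u - _) 0) ^ (-a))]
    exact kernel_one_aux ha ha' h

/-! ### The kernel of the Hermite sheet -/

variable {d q : ℕ} {H : Fin d → ℝ}

/-- The constant `∏ i, β(1/2 - (1-H_i)/q, 2(1-H_i)/q)^q`. -/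
def betaProd (H : Fin d → ℝ) (q : ℕ) : ℝ :=
  ∏ i, betaFn (1 / 2 - (1 - H i) / q) (2 * (1 - H i) / q) ^ q

theorem exponent_bounds (hq : 1 ≤ q) {h : ℝ} (hh : 1 / 2 < h ∧ h < 1) :
    0 < (1 - h) / q ∧ (1 - h) / q < 1 / 2 := by
  have hq' : (1 : ℝ) ≤ q := by exact_mod_cast hq
  refine ⟨div_pos (by linarith [hh.2]) (by linarith), ?_⟩
  rw [div_lt_iff₀ (by linarith)]
  nlinarith [hh.1]

theorem betaFn_exponent_pos (hq : 1 ≤ q) {h : ℝ} (hh : 1 / 2 < h ∧ h < 1) :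
    0 < betaFn (1 / 2 - (1 - h) / q) (2 * (1 - h) / q) := by
  obtain ⟨h1, h2⟩ := exponent_bounds hq hh
  exact betaFn_pos (by linarith) (by rw [mul_div_assoc]; linarith)

theorem betaProd_pos (hq : 1 ≤ q) (hH : ∀ i, 1 / 2 < H i ∧ H i < 1) : 0 < betaProd H q :=
  Finset.prod_pos fun i _ => pow_pos (betaFn_exponent_pos hq (hH i)) q

theorem factorial_mul_hermiteConst_sq (hq : 1 ≤ q) (hH : ∀ i, 1 / 2 < H i ∧ H i < 1) :
    (q.factorial : ℝ) * (hermiteConst H q ^ 2 * betaProd H q) = ∏ i, H i * (2 * H i - 1) := by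
  have hf : (q.factorial : ℝ) ≠ 0 := by exact_mod_cast q.factorial_ne_zero
  rw [hermiteConst, Real.sq_sqrt, Finset.prod_div_distrib, ← betaProd]
  · have := (betaProd_pos hq hH).ne'
    generalize ∏ i, H i * (2 * H i - 1) = c
    field_simp
  · refine mul_nonneg (by positivity) (Finset.prod_nonneg fun i _ => ?_)
    have h1 := (hH i).1
    exact div_nonneg (mul_nonneg (by linarith) (by linarith))
      (pow_nonneg (betaFn_exponent_pos hq (hH i)).le q)

theorem hermiteKernel_nonneg (u : Fin d → ℝ) (y : Fin q → Fin d → ℝ) :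
    0 ≤ hermiteKernel H q u y :=
  Finset.prod_nonneg fun _ _ => Finset.prod_nonneg fun _ _ => Real.rpow_nonneg (le_max_right _ _) _

theorem rieszKernel_nonneg (u v : Fin d → ℝ) : 0 ≤ rieszKernel H u v :=
  Finset.prod_nonneg fun _ _ => Real.rpow_nonneg (abs_nonneg _) _

theorem measurable_hermiteKernel {α : Type*} [MeasurableSpace α] {u : α → Fin d → ℝ}
    {y : α → Fin q → Fin d → ℝ} (hu : Measurable u) (hy : Measurable y) :
    Measurable fun a => hermiteKernel H q (u a) (y a) := by
  unfold hermiteKernel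
  fun_prop

theorem measurable_rieszKernel :
    Measurable fun p : (Fin d → ℝ) × (Fin d → ℝ) => rieszKernel H p.1 p.2 := by
  unfold rieszKernel
  fun_prop

theorem integral_hermiteKernel_mul (hq : 1 ≤ q) (hH : ∀ i, 1 / 2 < H i ∧ H i < 1)
    {u v : Fin d → ℝ} (huv : ∀ i, u i ≠ v i) :
    Integrable (fun y => hermiteKernel H q u y * hermiteKernel H q v y) ∧
    ∫ y, hermiteKernel H q u y * hermiteKernel H q v y = betaProd H q * rieszKernel H u v := by
  have hk : ∀ i, _ := fun i => kernel_one (a := 1 / 2 + (1 - H i) / q)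
    (by linarith [exponent_bounds hq (hH i)]) (by linarith [exponent_bounds hq (hH i)]) (huv i)
  have e : ∀ y : Fin q → Fin d → ℝ, hermiteKernel H q u y * hermiteKernel H q v y =
      ∏ j, ∏ i, ((max (u i - y j i) 0) ^ (-(1 / 2 + (1 - H i) / q)) *
        (max (v i - y j i) 0) ^ (-(1 / 2 + (1 - H i) / q))) := fun y => by
    simp only [hermiteKernel, ← Finset.prod_mul_distrib]
  simp_rw [e]
  constructor
  · exact Integrable.fintype_prod (μ := fun _ => volume)
      (f := fun (_ : Fin q) (x : Fin d → ℝ) => ∏ i,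
        ((max (u i - x i) 0) ^ (-(1 / 2 + (1 - H i) / q)) *
        (max (v i - x i) 0) ^ (-(1 / 2 + (1 - H i) / q))))
      fun _ => Integrable.fintype_prod (μ := fun _ => volume)
        (f := fun (i : Fin d) (x : ℝ) => (max (u i - x) 0) ^ (-(1 / 2 + (1 - H i) / q)) *
        (max (v i - x) 0) ^ (-(1 / 2 + (1 - H i) / q))) fun i => (hk i).1
  · rw [integral_fintype_prod_volume_eq_prod (f := fun (_ : Fin q) (x : Fin d → ℝ) => ∏ i,
        ((max (u i - x i) 0) ^ (-(1 / 2 + (1 - H i) / q)) *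
        (max (v i - x i) 0) ^ (-(1 / 2 + (1 - H i) / q)))),
      integral_fintype_prod_volume_eq_prod (f := fun (i : Fin d) (x : ℝ) =>
        (max (u i - x) 0) ^ (-(1 / 2 + (1 - H i) / q)) *
        (max (v i - x) 0) ^ (-(1 / 2 + (1 - H i) / q)))]
    rw [Finset.prod_const, Finset.card_univ, Fintype.card_fin, ← Finset.prod_pow, betaProd,
      rieszKernel, ← Finset.prod_mul_distrib]
    refine Finset.prod_congr rfl fun i _ => ?_
    have hq0 : (q : ℝ) ≠ 0 := by positivity
    rw [(hk i).2, mul_pow, ← Real.rpow_natCast (|u i - v i| ^ _), ← Real.rpow_mul (abs_nonneg _)]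
    -- The three exponent identities: `1 - a = 1/2 - (1 - H)/q`, `2a - 1 = 2(1 - H)/q` and `(1 - 2a)
    -- q = 2H - 2`.
    congr 3
    · ring_nf
    · field_simp; ring
    · field_simp; ring

theorem ae_forall_ne : ∀ᵐ p : (Fin d → ℝ) × (Fin d → ℝ), ∀ i, p.1 i ≠ p.2 i := by
  rw [ae_all_iff]
  intro i
  rw [Measure.volume_eq_prod, Measure.ae_prod_iff_ae_ae]
  · refine ae_of_all _ fun x => ?_
    have h : ∀ᵐ z : ℝ, z ≠ x i := by
      rw [ae_iff]; simp
    filter_upwards [(Measure.quasiMeasurePreserving_eval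
      (fun _ : Fin d => (volume : Measure ℝ)) i).ae h] with y hy using fun h => hy h.symm
  · exact (measurableSet_eq_fun (by fun_prop) (by fun_prop)).compl

end

section

variable {d q : ℕ} {H : Fin d → ℝ}

/-! ### The norm of the space of integrands as a double integral -/

/-- Some section at a point with `g x ≠ 0` is integrable, and dividing by `g x` recovers `g`. This
extracts absolute convergence of the integral defining `J f y` from Fubini. -/
theorem integrable_of_integrable_tensor {α : Type*} [MeasurableSpace α] {μ : Measure α} [SFinite μ]
    {g : α → ℝ} (h : Integrable (fun p : α × α => g p.1 * g p.2) (μ.prod μ)) : Integrable g μ := by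
  by_cases h0 : ∀ᵐ x ∂μ, g x = 0
  · exact (integrable_zero α ℝ μ).congr (by filter_upwards [h0] with x hx using hx.symm)
  · obtain ⟨x, hx, hx'⟩ := (h.prod_right_ae.and_frequently (not_eventually.1 h0)).exists
    exact (hx.const_mul (g x)⁻¹).congr (ae_of_all _ fun y => by field_simp)

theorem aestronglyMeasurable_mul_hermiteKernel {f : (Fin d → ℝ) → ℝ}
    (hf : AEStronglyMeasurable f volume) :
    AEStronglyMeasurable (fun p : (Fin q → Fin d → ℝ) × (Fin d → ℝ) =>
      f p.2 * hermiteKernel H q p.2 p.1) (volume.prod volume) :=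
  hf.comp_snd.mul (measurable_hermiteKernel measurable_snd measurable_fst).aestronglyMeasurable

theorem aestronglyMeasurable_J {f : (Fin d → ℝ) → ℝ} (hf : AEStronglyMeasurable f volume) :
    AEStronglyMeasurable (J H q f) volume :=
  (aestronglyMeasurable_mul_hermiteKernel hf).integral_prod_right'.const_mul _

theorem integral_tensor_hermiteKernel (hq : 1 ≤ q) (hH : ∀ i, 1 / 2 < H i ∧ H i < 1)
    (f : (Fin d → ℝ) → ℝ) : ∀ᵐ p : (Fin d → ℝ) × (Fin d → ℝ),
      Integrable (fun y => f p.1 * hermiteKernel H q p.1 y * (f p.2 * hermiteKernel H q p.2 y)) ∧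
      ∫ y, f p.1 * hermiteKernel H q p.1 y * (f p.2 * hermiteKernel H q p.2 y) =
        betaProd H q * (f p.1 * f p.2 * rieszKernel H p.1 p.2) := by
  filter_upwards [ae_forall_ne] with p hp
  obtain ⟨h1, h2⟩ := integral_hermiteKernel_mul hq hH hp
  have e : ∀ y, f p.1 * hermiteKernel H q p.1 y * (f p.2 * hermiteKernel H q p.2 y) =
      f p.1 * f p.2 * (hermiteKernel H q p.1 y * hermiteKernel H q p.2 y) := fun y => by ring
  simp_rw [e]
  refine ⟨h1.const_mul _, ?_⟩
  rw [integral_const_mul, h2]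
  ring

/-- The kernels are nonnegative, so the `y`-integral of the absolute value is the correlation
identity applied to `|f|`. -/
theorem integrable_tensor_hermiteKernel (hq : 1 ≤ q) (hH : ∀ i, 1 / 2 < H i ∧ H i < 1)
    {f : (Fin d → ℝ) → ℝ} (hf : AEStronglyMeasurable f volume)
    (hi : Integrable (fun p : (Fin d → ℝ) × (Fin d → ℝ) =>
      f p.1 * f p.2 * rieszKernel H p.1 p.2)) :
    Integrable (fun r : ((Fin d → ℝ) × (Fin d → ℝ)) × (Fin q → Fin d → ℝ) =>
      f r.1.1 * hermiteKernel H q r.1.1 r.2 * (f r.1.2 * hermiteKernel H q r.1.2 r.2))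
      (volume.prod volume) := by
  rw [integrable_prod_iff]
  · refine ⟨(integral_tensor_hermiteKernel hq hH f).mono fun p hp => hp.1, ?_⟩
    have h := hi.norm.const_mul (betaProd H q)
    refine h.congr ?_
    filter_upwards [integral_tensor_hermiteKernel hq hH fun u => ‖f u‖] with p hp
    rw [norm_mul, norm_mul, Real.norm_of_nonneg (rieszKernel_nonneg _ _), ← hp.2]
    refine integral_congr_ae (ae_of_all _ fun y => ?_)
    simp only [norm_mul]
    rw [Real.norm_of_nonneg (hermiteKernel_nonneg _ _),
      Real.norm_of_nonneg (hermiteKernel_nonneg _ _)]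
  · exact (hf.comp_fst.comp_fst.mul
        (measurable_hermiteKernel (by fun_prop) measurable_snd).aestronglyMeasurable).mul
      (hf.comp_snd.comp_fst.mul
        (measurable_hermiteKernel (by fun_prop) measurable_snd).aestronglyMeasurable)

/-- For fixed `y`, the square of `∫ f K` is an integral over pairs `(u, v)`. Exchanging it with the
integral over `y` leaves the correlation of the kernel. -/
theorem mem_hSpace_of_integrable (hq : 1 ≤ q) (hH : ∀ i, 1 / 2 < H i ∧ H i < 1)
    {f : (Fin d → ℝ) → ℝ} (hf : AEStronglyMeasurable f volume)
    (hi : Integrable (fun p : (Fin d → ℝ) × (Fin d → ℝ) =>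
      f p.1 * f p.2 * rieszKernel H p.1 p.2)) :
    f ∈ hSpace H q ∧ hNormSq H q f = doubleIntegral H f := by
  have hF := integrable_tensor_hermiteKernel hq hH hf hi
  have hsq : ∀ y, ∫ p : (Fin d → ℝ) × (Fin d → ℝ),
      f p.1 * hermiteKernel H q p.1 y * (f p.2 * hermiteKernel H q p.2 y) =
      (∫ u, f u * hermiteKernel H q u y) ^ 2 := fun y => by
    rw [sq]
    exact integral_prod_mul (fun u => f u * hermiteKernel H q u y)
      fun u => f u * hermiteKernel H q u y
  refine ⟨⟨hf, ?_, ?_⟩, ?_⟩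
  · exact hF.prod_left_ae.mono fun y hy => integrable_of_integrable_tensor hy
  · rw [memLp_two_iff_integrable_sq (aestronglyMeasurable_J hf)]
    refine (hF.integral_prod_right.const_mul (hermiteConst H q ^ 2)).congr
      (ae_of_all _ fun y => ?_)
    simp only [J, mul_pow]
    rw [hsq]
  · have h1 : ∫ y, J H q f y ^ 2 = hermiteConst H q ^ 2 * (betaProd H q *
        ∫ p : (Fin d → ℝ) × (Fin d → ℝ), f p.1 * f p.2 * rieszKernel H p.1 p.2) := by
      simp only [J, mul_pow]
      rw [integral_const_mul]
      simp_rw [← hsq]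
      rw [← integral_prod_symm _ hF, integral_prod _ hF,
        integral_congr_ae ((integral_tensor_hermiteKernel hq hH f).mono fun p hp => hp.2),
        integral_const_mul]
    rw [hNormSq, h1, doubleIntegral, ← factorial_mul_hermiteConst_sq hq hH, ← integral_prod _ hi]
    ring_nf
    rfl

/-! ### Bounded functions with bounded support -/

theorem integrable_indicator_abs_rpow {s M : ℝ} (hs : -1 < s) :
    Integrable ((Set.Icc (-M) M).indicator fun x : ℝ => |x| ^ s) := by
  rw [integrable_indicator_iff measurableSet_Icc]
  have h : IntervalIntegrable (fun x : ℝ => |x| ^ s) volume 0 |M| :=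
    (intervalIntegral.intervalIntegrable_rpow' hs).congr fun x hx => by
      rw [Set.uIoc_of_le (abs_nonneg M)] at hx
      rw [abs_of_pos hx.1]
  have h' : IntervalIntegrable (fun x : ℝ => |x| ^ s) volume (-|M|) 0 := by
    have h2 := h.comp_sub_left 0
    simp only [zero_sub, abs_neg, sub_zero] at h2
    exact h2.symm
  have h3 := h'.trans h
  rw [intervalIntegrable_iff_integrableOn_Icc_of_le (by linarith [abs_nonneg M])] at h3
  exact h3.mono_set (Set.Icc_subset_Icc (neg_le_neg (le_abs_self M)) (le_abs_self M))

/-- The function `f` is measurable, bounded, and vanishes outside of a bounded set. -/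
def IsBoundedSupported (f : (Fin d → ℝ) → ℝ) : Prop :=
  Measurable f ∧ ∃ C M : ℝ, (∀ u, |f u| ≤ C) ∧ ∀ u, f u ≠ 0 → ∀ i, |u i| ≤ M

theorem IsBoundedSupported.integrable (hH : ∀ i, 1 / 2 < H i ∧ H i < 1) {f : (Fin d → ℝ) → ℝ}
    (hf : IsBoundedSupported f) :
    Integrable (fun p : (Fin d → ℝ) × (Fin d → ℝ) => f p.1 * f p.2 * rieszKernel H p.1 p.2) := by
  obtain ⟨hm, C, M, hC, hM⟩ := hf
  have h1 : Integrable fun u : Fin d → ℝ => ∏ i, (Set.Icc (-M) M).indicator (fun _ => (1 : ℝ))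
      (u i) :=
    Integrable.fintype_prod (μ := fun _ => volume)
      fun i => (integrable_indicator_iff measurableSet_Icc).2 (integrableOn_const (by simp))
  have h2 : Integrable fun u : Fin d → ℝ => ∏ i, (Set.Icc (-(2 * M)) (2 * M)).indicator
      (fun x => |x| ^ (2 * H i - 2)) (u i) :=
    Integrable.fintype_prod (μ := fun _ => volume)
      (f := fun i => (Set.Icc (-(2 * M)) (2 * M)).indicator (fun x => |x| ^ (2 * H i - 2)))
      fun i => integrable_indicator_abs_rpow (by linarith [hH i])
  have h3 := (h1.convolution_integrand (ContinuousLinearMap.mul ℝ ℝ) h2).const_mul (C * C)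
  -- Where `f u * f v ≠ 0`, all `|u_i - v_i| ≤ 2M`. The integrand is thus dominated by `C²` times a
  -- convolution integrand: the indicator of a cube in `v` times the Riesz kernel truncated at `2M`
  -- in `u - v`.
  refine h3.mono (by
    exact ((hm.comp measurable_fst).mul (hm.comp measurable_snd)).aestronglyMeasurable.mul
      measurable_rieszKernel.aestronglyMeasurable) (ae_of_all _ fun p => ?_)
  by_cases hp : f p.1 = 0 ∨ f p.2 = 0
  · have : f p.1 * f p.2 * rieszKernel H p.1 p.2 = 0 := by rcases hp with h | h <;> simp [h]
    rw [this, norm_zero]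
    exact norm_nonneg _
  · push Not at hp
    have hu := hM _ hp.1
    have hv := hM _ hp.2
    have e1 : ∏ i, (Set.Icc (-M) M).indicator (fun _ => (1 : ℝ)) (p.2 i) = 1 :=
      Finset.prod_eq_one fun i _ => Set.indicator_of_mem (Set.mem_Icc.2 (abs_le.1 (hv i))) _
    have e2 : ∏ i, (Set.Icc (-(2 * M)) (2 * M)).indicator
        (fun x => |x| ^ (2 * H i - 2)) ((p.1 - p.2) i) = rieszKernel H p.1 p.2 := by
      refine Finset.prod_congr rfl fun i _ => ?_
      have h1 := abs_le.1 (hu i)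
      have h2 := abs_le.1 (hv i)
      rw [Set.indicator_of_mem, Pi.sub_apply]
      simp only [Pi.sub_apply, Set.mem_Icc]
      constructor <;> linarith
    simp only [ContinuousLinearMap.mul_apply', e1, e2, one_mul, norm_mul]
    gcongr
    · exact (hC _).trans (le_abs_self C)
    · exact (hC _).trans (le_abs_self C)

theorem IsBoundedSupported.add {f g : (Fin d → ℝ) → ℝ} (hf : IsBoundedSupported f)
    (hg : IsBoundedSupported g) : IsBoundedSupported (f + g) := by
  obtain ⟨hf, C, M, hC, hM⟩ := hf
  obtain ⟨hg, C', M', hC', hM'⟩ := hg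
  refine ⟨hf.add hg, C + C', max M M', fun u => (abs_add_le _ _).trans (add_le_add (hC u) (hC' u)),
    fun u hu i => ?_⟩
  by_cases h : f u = 0
  · exact (hM' u (fun h' => hu (by simp [h, h'])) i).trans (le_max_right _ _)
  · exact (hM u h i).trans (le_max_left _ _)

theorem Rect.measurableSet_toSet (R : Rect d) : MeasurableSet R.toSet := by
  have : R.toSet = Set.univ.pi fun i => Set.Ioc (R.lower i) (R.upper i) := by
    ext u; simp [Rect.toSet]
  rw [this]
  exact MeasurableSet.univ_pi fun i => measurableSet_Ioc

theorem isBoundedSupported_elemFun (e : Rect d →₀ ℝ) : IsBoundedSupported (elemFun e) := by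
  induction e using Finsupp.induction_linear with
  | zero =>
    have : elemFun (0 : Rect d →₀ ℝ) = 0 := by ext; simp [elemFun]
    rw [this]
    exact ⟨measurable_zero, 0, 0, by simp, by simp⟩
  | add e e' h h' =>
    have : elemFun (e + e') = elemFun e + elemFun e' := by
      ext u
      simp only [elemFun, Pi.add_apply]
      exact Finsupp.sum_add_index' (by simp) (by intros; ring)
    rw [this]
    exact h.add h'
  | single R a =>
    have : elemFun (Finsupp.single R a) = fun u => a * R.toSet.indicator (fun _ => (1 : ℝ)) u := by
      ext u; simp [elemFun]
    rw [this]
    refine ⟨(measurable_const.indicator R.measurableSet_toSet).const_mul a, |a|,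
      ∑ i, (|R.lower i| + |R.upper i|), fun u => ?_, fun u hu i => ?_⟩
    · rw [abs_mul]
      refine mul_le_of_le_one_right (abs_nonneg a) ?_
      by_cases h : u ∈ R.toSet <;> simp [h]
    · have h : u ∈ R.toSet := by
        by_contra h; exact hu (by simp [h])
      refine le_trans ?_ (Finset.single_le_sum
        (f := fun i => |R.lower i| + |R.upper i|) (fun i _ => by positivity) (Finset.mem_univ i))
      have := h i
      rw [abs_le]
      constructor <;> linarith [neg_abs_le (R.lower i), le_abs_self (R.upper i),
        abs_nonneg (R.lower i), abs_nonneg (R.upper i)]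

theorem isBoundedSupported_orientedIndicator (t : Fin d → ℝ) :
    IsBoundedSupported (orientedIndicator t) := by
  have h1 : ∀ x y : ℝ, |(Set.Ioc 0 x).indicator (fun _ => (1 : ℝ)) y -
      (Set.Ioc x 0).indicator (fun _ => (1 : ℝ)) y| ≤ 1 := fun x y => by
    simp only [Set.indicator_apply, Set.mem_Ioc]
    split_ifs <;> norm_num
  refine ⟨?_, 1, ∑ i, |t i|, fun u => ?_, fun u hu i => ?_⟩
  · exact Finset.measurable_prod _ fun i _ =>
      ((measurable_const.indicator measurableSet_Ioc).comp (measurable_pi_apply i)).sub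
      ((measurable_const.indicator measurableSet_Ioc).comp (measurable_pi_apply i))
  · rw [orientedIndicator, Finset.abs_prod]
    exact Finset.prod_le_one (fun _ _ => abs_nonneg _) fun i _ => h1 _ _
  · refine le_trans ?_ (Finset.single_le_sum
        (f := fun i => |t i|) (fun i _ => abs_nonneg _) (Finset.mem_univ i))
    have h := Finset.prod_ne_zero_iff.1 hu i (Finset.mem_univ i)
    by_contra hlt
    refine h ?_
    rw [Set.indicator_of_notMem, Set.indicator_of_notMem, sub_zero]
    · rintro ⟨h1, h2⟩
      rw [abs_of_nonpos h2, abs_of_neg (h1.trans_le h2)] at hlt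
      linarith
    · rintro ⟨h1, h2⟩
      rw [abs_of_pos h1, abs_of_pos (h1.trans_le h2)] at hlt
      linarith

end

section

variable {Ω : Type*} [MeasurableSpace Ω] {P : Measure Ω}

/-! ### Moments of products of jointly Gaussian variables -/

theorem memLp_mul_of_forall {f g : Ω → ℝ} (hf : ∀ p : ENNReal, p ≠ ⊤ → MemLp f p P)
    (hg : ∀ p : ENNReal, p ≠ ⊤ → MemLp g p P) (p : ENNReal) (hp : p ≠ ⊤) :
    MemLp (fun ω => f ω * g ω) p P := by
  have h2 : 2 * p ≠ ⊤ := ENNReal.mul_ne_top (by simp) hp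
  have : ENNReal.HolderTriple (2 * p) (2 * p) p := ⟨by
    rw [ENNReal.mul_inv (by simp) (by simp), ← add_mul, ENNReal.inv_two_add_inv_two, one_mul]⟩
  exact (hg _ h2).mul' (hf _ h2)

theorem memLp_prod_of_forall [IsFiniteMeasure P] {ι : Type*} (s : Finset ι) {f : ι → Ω → ℝ}
    (hf : ∀ i, ∀ p : ENNReal, p ≠ ⊤ → MemLp (f i) p P) (p : ENNReal) (hp : p ≠ ⊤) :
    MemLp (fun ω => ∏ i ∈ s, f i ω) p P := by
  induction s using Finset.cons_induction generalizing p with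
  | empty => simpa using memLp_const 1
  | cons i s hi ih =>
    simp only [Finset.prod_cons]
    exact memLp_mul_of_forall (hf i) ih p hp

theorem exists_perm_of_forall_mem_range {ι : Type*} [Finite ι] (τ : ι → Option ι)
    (h : ∀ j, ∃ k, τ k = some j) : ∃ σ : Equiv.Perm ι, ∀ k, τ k = some (σ k) := by
  choose g hg using h
  have hinj : Function.Injective g := fun a b hab => by
    have := hg a
    rw [hab, hg b] at this
    exact (Option.some.inj this).symm
  let e := Equiv.ofBijective g (Finite.injective_iff_bijective.1 hinj)
  refine ⟨e.symm, fun k => ?_⟩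
  rw [← hg (e.symm k)]
  exact congrArg τ (e.apply_symm_apply k).symm

section Wick

variable {ι : Type*} [Fintype ι] {Z : ι ⊕ ι → Ω → ℝ}

/-- Setting the coordinate `inl j` to `0` leaves a vector jointly Gaussian with and uncorrelated to
`Z (inl j)`, hence independent of it. By `hgj` the function `g` sees only that vector, so the
expectation factors through `E[Z (inl j)] = 0`. -/
theorem integral_eq_zero_of_orthogonal [DecidableEq ι] [IsProbabilityMeasure P]
    (hG : HasGaussianLaw (fun ω i => Z i ω) P) (j : ι)
    (h0 : ∫ ω, Z (.inl j) ω ∂P = 0)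
    (horth : ∀ i, i ≠ Sum.inl j → ∫ ω, Z (.inl j) ω * Z i ω ∂P = 0)
    {g : (ι ⊕ ι → ℝ) → ℝ} (hg : Measurable g)
    (hgj : ∀ z, g (Function.update z (.inl j) 0) = g z) :
    ∫ ω, Z (.inl j) ω * g (fun i => Z i ω) ∂P = 0 := by
  have hZ : ∀ i, HasGaussianLaw (Z i) P := fun i => hG.eval i
  let Z' : ι ⊕ ι → Ω → ℝ := fun i ω => if i = Sum.inl j then 0 else Z i ω
  have hZ' : ∀ ω, (fun i => Z' i ω) = Function.update (fun i => Z i ω) (.inl j) 0 := fun ω => by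
    ext i
    simp only [Z', Function.update_apply]
  let L : (ι ⊕ ι → ℝ) →L[ℝ] (Unit → ℝ) × (ι ⊕ ι → ℝ) :=
    ContinuousLinearMap.prod (ContinuousLinearMap.pi fun _ => ContinuousLinearMap.proj (.inl j))
      (ContinuousLinearMap.pi fun i => if i = Sum.inl j then 0 else ContinuousLinearMap.proj i)
  have hL : (fun ω => ((fun _ : Unit => Z (.inl j) ω), fun i => Z' i ω)) =
      fun ω => L (fun i => Z i ω) := by
    funext ω
    refine Prod.ext rfl (funext fun i => ?_)
    simp only [Z', L, ContinuousLinearMap.prod_apply, ContinuousLinearMap.pi_apply]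
    split_ifs <;> rfl
  have hind : IndepFun (fun ω (_ : Unit) => Z (.inl j) ω) (fun ω i => Z' i ω) P := by
    refine HasGaussianLaw.indepFun_of_covariance_eval (X := fun (_ : Unit) => Z (.inl j))
      (by rw [hL]; exact hG.map_fun L) fun _ i => ?_
    by_cases hi : i = Sum.inl j
    · have : Z' i = fun _ => 0 := by funext ω; simp [Z', hi]
      rw [this]; exact covariance_const_right _
    · have : Z' i = Z i := by funext ω; simp [Z', hi]
      rw [this, covariance_eq_sub (hZ _).memLp_two (hZ _).memLp_two, h0, zero_mul, sub_zero]
      exact horth i hi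
  have hev : Measurable fun x : Unit → ℝ => x () := measurable_pi_apply ()
  have h2 := hind.comp hev hg
  have h3 := h2.integral_fun_mul_eq_mul_integral (hZ _).aemeasurable.aestronglyMeasurable (by
    refine (hg.comp_aemeasurable (aemeasurable_pi_iff.2 fun i => ?_)).aestronglyMeasurable
    by_cases hi : i = Sum.inl j
    · simp [Z', hi]
    · simpa [Z', hi] using (hZ i).aemeasurable)
  simp only [Function.comp_apply, hZ', hgj, h0, zero_mul] at h3
  exact h3

/-- The coefficient of a term in the expansion of `∏ k, (Z (inr k) + ∑ j, c j k * Z (inl j))`. -/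
def expansionTerm (c : ι → ι → ℝ) (τ : ι → Option ι) (z : ι ⊕ ι → ℝ) : ℝ :=
  ∏ k, (τ k).elim (z (.inr k)) fun j => c j k * z (.inl j)

theorem sum_expansionTerm [DecidableEq ι] (c : ι → ι → ℝ) (z : ι ⊕ ι → ℝ) :
    ∏ k, (z (.inr k) + ∑ j, c j k * z (.inl j)) = ∑ τ, expansionTerm c τ z := by
  have := Finset.prod_univ_sum (fun _ : ι => (Finset.univ : Finset (Option ι)))
    fun k o => o.elim (z (.inr k)) fun j => c j k * z (.inl j)
  simp only [Fintype.sum_option, Option.elim, Fintype.piFinset_univ] at this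
  exact this

theorem integrable_prod_mul_expansionTerm [IsProbabilityMeasure P]
    (hG : HasGaussianLaw (fun ω i => Z i ω) P) (c : ι → ι → ℝ) (τ : ι → Option ι) :
    Integrable (fun ω => (∏ j, Z (.inl j) ω) * expansionTerm c τ (fun i => Z i ω)) P := by
  refine memLp_one_iff_integrable.1 (memLp_mul_of_forall
    (memLp_prod_of_forall _ fun j p hp => (hG.eval (.inl j)).memLp hp)
    (memLp_prod_of_forall _ fun k p hp => ?_) 1 (by simp))
  cases τ k with
  | none => exact (hG.eval (.inr k)).memLp hp
  | some j => exact ((hG.eval (.inl j)).memLp hp).const_mul _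

/-- If `τ` misses `j`, then `Z (inl j)` occurs exactly once, and everything else is a function of
the other coordinates. -/
theorem integral_prod_mul_expansionTerm_eq_zero [DecidableEq ι] [IsProbabilityMeasure P]
    (hG : HasGaussianLaw (fun ω i => Z i ω) P)
    (h0 : ∀ i, ∫ ω, Z i ω ∂P = 0)
    (horth : ∀ j i, i ≠ Sum.inl j → ∫ ω, Z (.inl j) ω * Z i ω ∂P = 0)
    (c : ι → ι → ℝ) (τ : ι → Option ι) (j : ι) (hj : ∀ k, τ k ≠ some j) :
    ∫ ω, (∏ j, Z (.inl j) ω) * expansionTerm c τ (fun i => Z i ω) ∂P = 0 := by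
  have := integral_eq_zero_of_orthogonal hG j (h0 _) (horth j)
    (g := fun z => (∏ i ∈ Finset.univ.erase j, z (.inl i)) * expansionTerm c τ z) (by
      refine Measurable.mul (by fun_prop) (Finset.measurable_prod _ fun k _ => ?_)
      cases τ k <;> simp <;> fun_prop) (fun z => by
      congr 1
      · refine Finset.prod_congr rfl fun i hi => ?_
        rw [Function.update_of_ne]
        simpa using Finset.ne_of_mem_erase hi
      · refine Finset.prod_congr rfl fun k _ => ?_
        have := hj k
        cases hk : τ k with
        | none => simp
        | some i =>
          rw [hk] at this
          simp only [Option.elim]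
          rw [Function.update_of_ne]
          simpa using this)
  rw [← this]
  refine integral_congr_ae (ae_of_all _ fun ω => ?_)
  simp only
  rw [← Finset.mul_prod_erase _ _ (Finset.mem_univ j), mul_assoc]

/-- Every `Z (inl j)` now occurs squared, and these orthogonal Gaussian variables are independent.
-/
theorem integral_prod_mul_expansionTerm_perm [IsProbabilityMeasure P]
    (hG : HasGaussianLaw (fun ω i => Z i ω) P)
    (h0 : ∀ i, ∫ ω, Z i ω ∂P = 0)
    (horth : ∀ j i, i ≠ Sum.inl j → ∫ ω, Z (.inl j) ω * Z i ω ∂P = 0)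
    (c : ι → ι → ℝ) (σ : Equiv.Perm ι) :
    ∫ ω, (∏ j, Z (.inl j) ω) * expansionTerm c (fun k => some (σ k)) (fun i => Z i ω) ∂P =
      ∏ k, c (σ k) k * ∫ ω, Z (.inl (σ k)) ω * Z (.inl (σ k)) ω ∂P := by
  let L : (ι ⊕ ι → ℝ) →L[ℝ] (ι → ℝ) :=
    ContinuousLinearMap.pi fun j => ContinuousLinearMap.proj (Sum.inl j)
  have hind : iIndepFun (fun j : ι => Z (.inl j)) P := by
    refine HasGaussianLaw.iIndepFun_of_covariance_eq_zero (hG.map_fun L) fun i j hij => ?_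
    rw [covariance_eq_sub (hG.eval _).memLp_two (hG.eval _).memLp_two, h0, zero_mul, sub_zero]
    exact horth i _ (by simpa using hij.symm)
  have hsq := (hind.comp (fun _ x => x * x)
    (fun _ => measurable_id.mul measurable_id)).integral_fun_prod_eq_prod_integral (fun j => by
      have := (hG.eval (.inl j)).aemeasurable
      exact (this.mul this).aestronglyMeasurable)
  simp only [Function.comp_apply] at hsq
  rw [Finset.prod_mul_distrib, Equiv.prod_comp σ (fun j => ∫ ω, Z (.inl j) ω * Z (.inl j) ω ∂P),
    ← hsq, ← integral_const_mul]
  refine integral_congr_ae (ae_of_all _ fun ω => ?_)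
  simp only [expansionTerm, Option.elim]
  rw [Finset.prod_mul_distrib, Equiv.prod_comp σ (fun j => Z (.inl j) ω), Finset.prod_mul_distrib]
  ring

/-- Only the terms `τ` that hit every `j` survive, and by counting these are the permutations. -/
theorem integral_prod_mul_prod_add_sum [DecidableEq ι] [IsProbabilityMeasure P]
    (hG : HasGaussianLaw (fun ω i => Z i ω) P)
    (h0 : ∀ i, ∫ ω, Z i ω ∂P = 0)
    (horth : ∀ j i, i ≠ Sum.inl j → ∫ ω, Z (.inl j) ω * Z i ω ∂P = 0) (c : ι → ι → ℝ) :
    ∫ ω, (∏ j, Z (.inl j) ω) * ∏ k, (Z (.inr k) ω + ∑ j, c j k * Z (.inl j) ω) ∂P =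
      ∑ σ : Equiv.Perm ι, ∏ k, c (σ k) k * ∫ ω, Z (.inl (σ k)) ω * Z (.inl (σ k)) ω ∂P := by
  have e : ∀ ω, (∏ j, Z (.inl j) ω) * ∏ k, (Z (.inr k) ω + ∑ j, c j k * Z (.inl j) ω) =
      ∑ τ, (∏ j, Z (.inl j) ω) * expansionTerm c τ (fun i => Z i ω) := fun ω => by
    rw [← Finset.mul_sum, ← sum_expansionTerm]
  simp_rw [e]
  rw [integral_finsetSum _ fun τ _ => integrable_prod_mul_expansionTerm hG c τ]
  symm
  refine Finset.sum_of_injOn (fun σ k => some (σ k)) (fun σ _ σ' _ h => ?_) (by simp)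
    (fun τ _ hτ => ?_) fun σ _ => ?_
  · ext k
    exact Option.some.inj (congrFun h k)
  · by_cases h : ∀ j, ∃ k, τ k = some j
    · obtain ⟨σ, hσ⟩ := exists_perm_of_forall_mem_range τ h
      exact absurd ⟨σ, by simp, (funext hσ).symm⟩ hτ
    · push Not at h
      obtain ⟨j, hj⟩ := h
      exact integral_prod_mul_expansionTerm_eq_zero hG h0 horth c τ j hj
  · exact (integral_prod_mul_expansionTerm_perm hG h0 horth c σ).symm

/-- The expectation of `∏ X_j ∏ Y_k` for jointly Gaussian centered variables with `X` orthogonal. -/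
theorem integral_prod_mul_prod [DecidableEq ι] [IsProbabilityMeasure P] {X Y : ι → Ω → ℝ}
    (hG : HasGaussianLaw (fun ω i => Sum.elim X Y i ω) P)
    (hX0 : ∀ j, ∫ ω, X j ω ∂P = 0) (hY0 : ∀ j, ∫ ω, Y j ω ∂P = 0)
    (hX : ∀ j k, j ≠ k → ∫ ω, X j ω * X k ω ∂P = 0) (hXX : ∀ j, ∫ ω, X j ω * X j ω ∂P ≠ 0) :
    ∫ ω, (∏ j, X j ω) * ∏ k, Y k ω ∂P =
      ∑ σ : Equiv.Perm ι, ∏ k, ∫ ω, X (σ k) ω * Y k ω ∂P := by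
  have hXG : ∀ j, HasGaussianLaw (X j) P := fun j => hG.eval (.inl j)
  have hYG : ∀ j, HasGaussianLaw (Y j) P := fun j => hG.eval (.inr j)
  have hXYi : ∀ j k, Integrable (fun ω => X j ω * Y k ω) P := fun j k =>
    (hXG j).memLp_two.integrable_mul (hYG k).memLp_two
  have hXXi : ∀ j k, Integrable (fun ω => X j ω * X k ω) P := fun j k =>
    (hXG j).memLp_two.integrable_mul (hXG k).memLp_two
  -- Regression coefficients: the residual `Y' k` is orthogonal to every `X j`. The `Y' k` need not
  -- be orthogonal to each other.
  let c : ι → ι → ℝ := fun j k => (∫ ω, X j ω * Y k ω ∂P) / ∫ ω, X j ω * X j ω ∂P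
  let Y' : ι → Ω → ℝ := fun k ω => Y k ω - ∑ j, c j k * X j ω
  let L : (ι ⊕ ι → ℝ) →L[ℝ] (ι ⊕ ι → ℝ) := ContinuousLinearMap.pi
    (Sum.elim (fun j => ContinuousLinearMap.proj (.inl j)) fun k =>
      ContinuousLinearMap.proj (.inr k) - ∑ j, c j k • ContinuousLinearMap.proj (.inl j))
  have hL : (fun ω i => Sum.elim X Y' i ω) = fun ω => L (fun i => Sum.elim X Y i ω) := by
    funext ω i
    rcases i with j | k <;> simp [L, Y']
  have hG' : HasGaussianLaw (fun ω i => Sum.elim X Y' i ω) P := by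
    rw [hL]; exact hG.map_fun L
  have := integral_prod_mul_prod_add_sum hG' (fun i => ?_) (fun j i hi => ?_) c
  · simp only [Sum.elim_inl, Sum.elim_inr, Y', sub_add_cancel] at this
    rw [this]
    refine Finset.sum_congr rfl fun σ _ => Finset.prod_congr rfl fun k _ => ?_
    exact div_mul_cancel₀ _ (hXX _)
  · rcases i with j | k
    · exact hX0 j
    · simp only [Sum.elim_inr, Y']
      rw [integral_sub (hYG k).integrable
        (integrable_finsetSum _ fun j _ => (hXG j).integrable.const_mul _),
        integral_finsetSum _ fun j _ => (hXG j).integrable.const_mul _, hY0]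
      simp [integral_const_mul, hX0]
  · rcases i with i | k
    · exact hX j i fun h => hi (by rw [h])
    · simp only [Sum.elim_inr, Sum.elim_inl, Y', mul_sub, Finset.mul_sum, mul_left_comm (X j _)]
      rw [integral_sub (hXYi j k)
        (integrable_finsetSum _ fun i _ => (hXXi j i).const_mul _),
        integral_finsetSum _ fun i _ => (hXXi j i).const_mul _, Finset.sum_eq_single j]
      · rw [integral_const_mul, div_mul_cancel₀ _ (hXX _), sub_self]
      · intro i _ hij
        rw [integral_const_mul, hX j i hij.symm, mul_zero]
      · simp

end Wick

end

section

variable {d q : ℕ} {Ω : Type*} [MeasurableSpace Ω] {P : Measure Ω}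

/-! ### Rectangular increments -/

/-- The corner of the rectangle `R` indexed by `r ∈ {0,1}^d`. -/
def Rect.corner (R : Rect d) (r : Fin d → Fin 2) (i : Fin d) : ℝ :=
  R.lower i + ((r i : ℕ) : ℝ) * (R.upper i - R.lower i)

/-- The sign with which a corner enters a rectangular increment. -/
def cornerSign (r : Fin d → Fin 2) : ℝ :=
  (-1 : ℝ) ^ (d - ∑ i, (r i : ℕ))

theorem Rect.increment_eq (R : Rect d) (x : (Fin d → ℝ) → ℝ) :
    R.increment x = ∑ r, cornerSign r * x (R.corner r) := rfl

theorem cornerSign_eq_prod (r : Fin d → Fin 2) :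
    cornerSign r = ∏ i, (-1 : ℝ) ^ (1 - (r i : ℕ)) := by
  -- Truncated subtraction distributes over the sum because each `r i ≤ 1`.
  rw [Finset.prod_pow_eq_pow_sum, cornerSign, Finset.sum_tsub_distrib]
  · simp
  · intro i _
    have := (r i).isLt
    lia

theorem Rect.increment_prod (R : Rect d) (x : Fin d → ℝ → ℝ) :
    R.increment (fun t => ∏ i, x i (t i)) = ∏ i, (x i (R.upper i) - x i (R.lower i)) := by
  have h := Finset.prod_univ_sum (fun _ : Fin d => (Finset.univ : Finset (Fin 2)))
    fun i r => (-1 : ℝ) ^ (1 - (r : ℕ)) * x i (R.lower i + ((r : ℕ) : ℝ) * (R.upper i - R.lower i))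
  rw [Fintype.piFinset_univ] at h
  rw [Rect.increment_eq]
  simp only [cornerSign_eq_prod, ← Finset.prod_mul_distrib, Rect.corner]
  rw [← h]
  refine Finset.prod_congr rfl fun i _ => ?_
  simp [Fin.sum_univ_two]
  ring

theorem Rect.indicator_eq_prod (R : Rect d) (u : Fin d → ℝ) :
    R.toSet.indicator (fun _ => (1 : ℝ)) u =
      ∏ i, (Set.Ioc (R.lower i) (R.upper i)).indicator (fun _ => (1 : ℝ)) (u i) := by
  by_cases h : u ∈ R.toSet
  · rw [Set.indicator_of_mem h]
    exact (Finset.prod_eq_one fun i _ => Set.indicator_of_mem (Set.mem_Ioc.2 (h i)) _).symm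
  · rw [Set.indicator_of_notMem h]
    have h' : ∃ i, ¬ (R.lower i < u i ∧ u i ≤ R.upper i) := by
      by_contra hc
      push Not at hc
      exact h fun i => hc i
    obtain ⟨i, hi⟩ := h'
    exact (Finset.prod_eq_zero (Finset.mem_univ i)
      (Set.indicator_of_notMem (fun h => hi (Set.mem_Ioc.1 h)) _)).symm

/-- The orientation makes this true whatever the signs of the endpoints. It is the link between
increments of `Z` and `J` of the indicator of a rectangle. -/
theorem Rect.increment_orientedIndicator (R : Rect d) (u : Fin d → ℝ) :
    R.increment (fun t => orientedIndicator t u) = R.toSet.indicator (fun _ => (1 : ℝ)) u := by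
  rw [R.indicator_eq_prod]
  refine (R.increment_prod fun i t => (Set.Ioc 0 t).indicator (fun _ => (1 : ℝ)) (u i) -
    (Set.Ioc t 0).indicator (fun _ => (1 : ℝ)) (u i)).trans (Finset.prod_congr rfl fun i _ => ?_)
  have := R.lower_lt_upper i
  simp only [Set.indicator_apply, Set.mem_Ioc]
  split_ifs <;> grind

theorem integral_indicator_Ioc_mul {a b a' b' : ℝ} (h : a < b) (h' : a' < b') :
    ∫ x, (Set.Ioc a b).indicator (fun _ => (1 : ℝ)) x *
      (Set.Ioc a' b').indicator (fun _ => (1 : ℝ)) x =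
    (((|b| + |b'| - |b - b'|) / 2 - (|b| + |a'| - |b - a'|) / 2) -
      ((|a| + |b'| - |a - b'|) / 2 - (|a| + |a'| - |a - a'|) / 2)) := by
  have e : ∀ x, (Set.Ioc a b).indicator (fun _ => (1 : ℝ)) x *
      (Set.Ioc a' b').indicator (fun _ => (1 : ℝ)) x =
      (Set.Ioc (max a a') (min b b')).indicator (fun _ => (1 : ℝ)) x := fun x => by
    simp only [Set.indicator_apply, Set.mem_Ioc, max_lt_iff, le_min_iff]
    split_ifs <;> grind
  simp_rw [e]
  rw [integral_indicator measurableSet_Ioc, setIntegral_const, smul_eq_mul, mul_one,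
    Real.volume_real_Ioc]
  rcases le_total b b' with h1 | h1 <;> rcases le_total a a' with h2 | h2 <;>
    rcases le_total b a' with h3 | h3 <;> rcases le_total a b' with h4 | h4 <;>
    simp only [h1, h2, h3, h4, min_eq_left, min_eq_right, max_eq_left, max_eq_right,
      abs_of_nonneg, abs_of_nonpos, sub_nonneg, sub_nonpos] <;>
    grind

theorem integrable_indicator_toSet (R : Rect d) :
    Integrable (R.toSet.indicator fun _ => (1 : ℝ)) := by
  simp_rw [funext R.indicator_eq_prod]
  exact Integrable.fintype_prod (μ := fun _ => volume)
    (f := fun i => (Set.Ioc (R.lower i) (R.upper i)).indicator (fun _ => (1 : ℝ)))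
    fun i => (integrable_indicator_iff measurableSet_Ioc).2 (integrableOn_const (by simp))

/-- Both sides factor over coordinates, which leaves the overlap length of two intervals. It gives
the white-noise covariance of the increments of `W`. -/
theorem Rect.increment_increment_covariance (R R' : Rect d) :
    R.increment (fun s => R'.increment fun t => ∏ i, (|s i| + |t i| - |s i - t i|) / 2) =
      ∫ u, R.toSet.indicator (fun _ => (1 : ℝ)) u * R'.toSet.indicator (fun _ => (1 : ℝ)) u := by
  have h : ∀ s : Fin d → ℝ, R'.increment (fun t => ∏ i, (|s i| + |t i| - |s i - t i|) / 2) =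
      ∏ i, ((|s i| + |R'.upper i| - |s i - R'.upper i|) / 2 -
        (|s i| + |R'.lower i| - |s i - R'.lower i|) / 2) := fun s =>
    R'.increment_prod fun i t => (|s i| + |t| - |s i - t|) / 2
  simp_rw [h]
  rw [R.increment_prod fun i s => (|s| + |R'.upper i| - |s - R'.upper i|) / 2 -
        (|s| + |R'.lower i| - |s - R'.lower i|) / 2]
  simp_rw [Rect.indicator_eq_prod, ← Finset.prod_mul_distrib]
  rw [integral_fintype_prod_volume_eq_prod (f := fun i x =>
    (Set.Ioc (R.lower i) (R.upper i)).indicator (fun _ => (1 : ℝ)) x *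
      (Set.Ioc (R'.lower i) (R'.upper i)).indicator (fun _ => (1 : ℝ)) x)]
  refine Finset.prod_congr rfl fun i _ => ?_
  rw [integral_indicator_Ioc_mul (R.lower_lt_upper i) (R'.lower_lt_upper i)]

/-! ### Increments of the Brownian sheet -/

variable {W : (Fin d → ℝ) → Ω → ℝ}

namespace IsBrownianSheet

theorem isGaussianProcess_increment (hW : IsBrownianSheet W P) :
    IsGaussianProcess (fun (R : Rect d) ω => R.increment fun t => W t ω) P := by
  classical
  refine hW.isGaussianProcess.of_isGaussianProcess fun R => ?_
  have hmem : ∀ r, R.corner r ∈ Finset.image R.corner Finset.univ := fun r =>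
    Finset.mem_image_of_mem _ (Finset.mem_univ r)
  refine ⟨Finset.image R.corner Finset.univ, ∑ r : Fin d → Fin 2, cornerSign r •
    ContinuousLinearMap.proj (R := ℝ) ⟨R.corner r, hmem r⟩, fun ω => ?_⟩
  simp [Rect.increment_eq, Finset.restrict_def]

theorem hasGaussianLaw_increment (hW : IsBrownianSheet W P) {ι : Type*} [Fintype ι]
    (R : ι → Rect d) : HasGaussianLaw (fun ω i => (R i).increment fun t => W t ω) P := by
  let L : (↥(Finset.univ : Finset ι) → ℝ) →L[ℝ] (ι → ℝ) :=
    ContinuousLinearMap.pi fun i => ContinuousLinearMap.proj ⟨i, Finset.mem_univ i⟩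
  exact ((hW.isGaussianProcess_increment.comp_right R).hasGaussianLaw Finset.univ).map_fun L

theorem integral_increment (hW : IsBrownianSheet W P) (R : Rect d) :
    ∫ ω, R.increment (fun t => W t ω) ∂P = 0 := by
  simp only [Rect.increment_eq]
  rw [integral_finsetSum _ fun r _ =>
    (hW.isGaussianProcess.hasGaussianLaw_eval _).integrable.const_mul _]
  simp [integral_const_mul, hW.integral_eq_zero]

theorem integral_increment_mul (hW : IsBrownianSheet W P) (R R' : Rect d) :
    ∫ ω, R.increment (fun t => W t ω) * R'.increment (fun t => W t ω) ∂P =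
      ∫ u, R.toSet.indicator (fun _ => (1 : ℝ)) u * R'.toSet.indicator (fun _ => (1 : ℝ)) u := by
  have hi : ∀ s t, Integrable (fun ω => W s ω * W t ω) P := fun s t =>
    (hW.isGaussianProcess.hasGaussianLaw_eval s).memLp_two.integrable_mul
      (hW.isGaussianProcess.hasGaussianLaw_eval t).memLp_two
  rw [← Rect.increment_increment_covariance]
  simp only [Rect.increment_eq, Finset.sum_mul_sum]
  rw [integral_finsetSum _ fun r _ => integrable_finsetSum _ fun r' _ => by
    simp only [mul_mul_mul_comm]; exact (hi _ _).const_mul _]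
  refine Finset.sum_congr rfl fun r _ => ?_
  rw [integral_finsetSum _ fun r' _ => by
    simp only [mul_mul_mul_comm]; exact (hi _ _).const_mul _, Finset.mul_sum]
  refine Finset.sum_congr rfl fun r' _ => ?_
  simp only [mul_mul_mul_comm, integral_const_mul, hW.covariance_eq]
  rw [mul_assoc]

/-- The covariance of two products of increments over pairwise disjoint rectangles. -/
theorem integral_prod_increment_mul [IsProbabilityMeasure P] (hW : IsBrownianSheet W P)
    (A B : DisjointRects d q) :
    ∫ ω, (∏ j, (A.rect j).increment fun t => W t ω) *
        ∏ k, (B.rect k).increment fun t => W t ω ∂P =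
      ∑ σ : Equiv.Perm (Fin q), ∏ k, ∫ u, (A.rect (σ k)).toSet.indicator (fun _ => (1 : ℝ)) u *
        (B.rect k).toSet.indicator (fun _ => (1 : ℝ)) u := by
  have hG : HasGaussianLaw (fun ω i => Sum.elim
      (fun j ω => (A.rect j).increment fun t => W t ω)
      (fun k ω => (B.rect k).increment fun t => W t ω) i ω) P := by
    convert hW.hasGaussianLaw_increment (Sum.elim A.rect B.rect) using 3 with ω i
    rcases i with j | k <;> rfl
  rw [integral_prod_mul_prod hG (fun j => hW.integral_increment _)
    (fun j => hW.integral_increment _) (fun j k hjk => ?_) fun j => ?_]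
  · simp_rw [hW.integral_increment_mul]
  · rw [hW.integral_increment_mul]
    have h0 : ∀ u, (A.rect j).toSet.indicator (fun _ => (1 : ℝ)) u *
        (A.rect k).toSet.indicator (fun _ => (1 : ℝ)) u = 0 := fun u => by
      by_cases h : u ∈ (A.rect j).toSet
      · rw [Set.indicator_of_notMem (Set.disjoint_left.1 (A.disjoint j k hjk) h), mul_zero]
      · rw [Set.indicator_of_notMem h, zero_mul]
    simp [h0]
  · rw [hW.integral_increment_mul]
    simp_rw [Rect.indicator_eq_prod, ← Finset.prod_mul_distrib]
    rw [integral_fintype_prod_volume_eq_prod (f := fun i x =>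
      (Set.Ioc ((A.rect j).lower i) ((A.rect j).upper i)).indicator (fun _ => (1 : ℝ)) x *
      (Set.Ioc ((A.rect j).lower i) ((A.rect j).upper i)).indicator (fun _ => (1 : ℝ)) x)]
    refine Finset.prod_ne_zero_iff.2 fun i _ => ?_
    have h := (A.rect j).lower_lt_upper i
    rw [integral_indicator_Ioc_mul h h, abs_sub_comm ((A.rect j).lower i) ((A.rect j).upper i),
      abs_of_pos (sub_pos.2 h)]
    simp only [sub_self, abs_zero]
    linarith

end IsBrownianSheet

end

section

variable {d q : ℕ} {Ω : Type*} [MeasurableSpace Ω] {P : Measure Ω}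

/-! ### Classes in `L²` -/

section ToL2

variable {α : Type*} [MeasurableSpace α] {μ : Measure α} {f g : α → ℝ}

theorem toL2_eq (h : MemLp g 2 μ) : toL2 μ g = h.toLp g := dif_pos h

theorem toL2_add (hf : MemLp f 2 μ) (hg : MemLp g 2 μ) :
    toL2 μ (f + g) = toL2 μ f + toL2 μ g := by
  rw [toL2_eq hf, toL2_eq hg, toL2_eq (hf.add hg), MemLp.toLp_add]

theorem toL2_const_smul (c : ℝ) (hf : MemLp f 2 μ) : toL2 μ (c • f) = c • toL2 μ f := by
  rw [toL2_eq hf, toL2_eq (hf.const_smul c), MemLp.toLp_const_smul]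

theorem toL2_congr (hf : MemLp f 2 μ) (h : f =ᵐ[μ] g) : toL2 μ f = toL2 μ g := by
  rw [toL2_eq hf, toL2_eq (hf.ae_eq h)]
  exact MemLp.toLp_congr _ _ h

theorem inner_toL2 (hf : MemLp f 2 μ) (hg : MemLp g 2 μ) :
    inner ℝ (toL2 μ f) (toL2 μ g) = ∫ x, f x * g x ∂μ := by
  rw [toL2_eq hf, toL2_eq hg, L2.inner_def]
  refine integral_congr_ae ?_
  filter_upwards [hf.coeFn_toLp, hg.coeFn_toLp] with x h1 h2
  rw [h1, h2]
  exact mul_comm _ _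

theorem norm_toL2_sq (hf : MemLp f 2 μ) : ‖toL2 μ f‖ ^ 2 = ∫ x, f x ^ 2 ∂μ := by
  rw [← real_inner_self_eq_norm_sq, inner_toL2 hf hf]
  simp only [sq]

end ToL2

/-! ### Elementary kernels and their multiple integrals -/

theorem elemKernel_add (e e' : DisjointRects d q →₀ ℝ) :
    elemKernel (e + e') = elemKernel e + elemKernel e' := by
  ext y
  exact Finsupp.sum_add_index' (by simp) (by intros; ring)

theorem elemKernel_smul (c : ℝ) (e : DisjointRects d q →₀ ℝ) :
    elemKernel (c • e) = c • elemKernel e := by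
  ext y
  rw [elemKernel, Finsupp.sum_smul_index' (by simp)]
  simp [elemKernel, Finsupp.mul_sum, mul_assoc]

theorem elemMultipleIntegral_add {Ω : Type*} (W : (Fin d → ℝ) → Ω → ℝ)
    (e e' : DisjointRects d q →₀ ℝ) :
    elemMultipleIntegral W (e + e') = elemMultipleIntegral W e + elemMultipleIntegral W e' := by
  ext y
  exact Finsupp.sum_add_index' (by simp) (by intros; ring)

theorem elemMultipleIntegral_smul {Ω : Type*} (W : (Fin d → ℝ) → Ω → ℝ) (c : ℝ)
    (e : DisjointRects d q →₀ ℝ) :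
    elemMultipleIntegral W (c • e) = c • elemMultipleIntegral W e := by
  ext y
  rw [elemMultipleIntegral, Finsupp.sum_smul_index' (by simp)]
  simp [elemMultipleIntegral, Finsupp.mul_sum, mul_assoc]

theorem memLp_prod_indicator (R : Fin q → Rect d) :
    MemLp (fun y : Fin q → Fin d → ℝ => ∏ j, (R j).toSet.indicator (fun _ => (1 : ℝ)) (y j)) 2
      volume := by
  have hi : Integrable fun y : Fin q → Fin d → ℝ =>
      ∏ j, (R j).toSet.indicator (fun _ => (1 : ℝ)) (y j) :=
    Integrable.fintype_prod (μ := fun _ => volume)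
      (f := fun j => (R j).toSet.indicator (fun _ => (1 : ℝ))) fun j => integrable_indicator_toSet _
  refine (memLp_two_iff_integrable_sq hi.aestronglyMeasurable).2 (hi.congr (ae_of_all _ fun y => ?_))
  simp only [← Finset.prod_pow]
  refine Finset.prod_congr rfl fun j _ => ?_
  by_cases h : y j ∈ (R j).toSet <;> simp [h]

theorem memLp_elemKernel (e : DisjointRects d q →₀ ℝ) : MemLp (elemKernel e) 2 volume :=
  memLp_finsetSum _ fun A _ => (memLp_prod_indicator A.rect).const_mul _

/-- The map sending an elementary kernel to its class in `L²`. -/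
def elemKernelL2 (d q : ℕ) :
    (DisjointRects d q →₀ ℝ) →ₗ[ℝ] Lp ℝ 2 (volume : Measure (Fin q → Fin d → ℝ)) where
  toFun e := toL2 volume (elemKernel e)
  map_add' e e' := by
    rw [elemKernel_add, toL2_add (memLp_elemKernel e) (memLp_elemKernel e')]
  map_smul' c e := by
    rw [elemKernel_smul, toL2_const_smul c (memLp_elemKernel e), RingHom.id_apply]

/-- The permutation of the variables of a kernel. -/
def permVars (σ : Equiv.Perm (Fin q)) (y : Fin q → Fin d → ℝ) : Fin q → Fin d → ℝ :=
  fun k => y (σ k)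

theorem measurePreserving_permVars (σ : Equiv.Perm (Fin q)) :
    MeasurePreserving (permVars (d := d) σ) volume volume := by
  convert volume_measurePreserving_piCongrLeft (fun _ : Fin q => Fin d → ℝ) σ.symm using 1
  funext y k
  simp [permVars, MeasurableEquiv.coe_piCongrLeft, Equiv.piCongrLeft_apply]

/-- The action of a permutation of the variables on `L²`. -/
def permL2 (d : ℕ) (σ : Equiv.Perm (Fin q)) :
    Lp ℝ 2 (volume : Measure (Fin q → Fin d → ℝ)) →ₗᵢ[ℝ]
      Lp ℝ 2 (volume : Measure (Fin q → Fin d → ℝ)) :=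
  Lp.compMeasurePreservingₗᵢ ℝ (permVars σ) (measurePreserving_permVars σ)

theorem permL2_toL2 (σ : Equiv.Perm (Fin q)) {g : (Fin q → Fin d → ℝ) → ℝ} (hg : MemLp g 2 volume) :
    permL2 d σ (toL2 volume g) = toL2 volume (g ∘ permVars σ) := by
  rw [toL2_eq hg, toL2_eq (hg.comp_measurePreserving (measurePreserving_permVars σ))]
  exact Lp.toLp_compMeasurePreserving hg (measurePreserving_permVars σ)

namespace IsBrownianSheet

variable {W : (Fin d → ℝ) → Ω → ℝ}

theorem memLp_prod_increment [IsProbabilityMeasure P] (hW : IsBrownianSheet W P)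
    (R : Fin q → Rect d) : MemLp (fun ω => ∏ j, (R j).increment fun t => W t ω) 2 P :=
  memLp_prod_of_forall _ (fun j _ hp =>
    (hW.isGaussianProcess_increment.hasGaussianLaw_eval (R j)).memLp hp) 2 (by simp)

theorem memLp_elemMultipleIntegral [IsProbabilityMeasure P] (hW : IsBrownianSheet W P)
    (e : DisjointRects d q →₀ ℝ) : MemLp (elemMultipleIntegral W e) 2 P :=
  memLp_finsetSum _ fun A _ => (hW.memLp_prod_increment A.rect).const_mul _

/-- The multiple integral of elementary kernels as a linear map. -/
def elemMultipleIntegralL2 [IsProbabilityMeasure P] (hW : IsBrownianSheet W P) (q : ℕ) :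
    (DisjointRects d q →₀ ℝ) →ₗ[ℝ] Lp ℝ 2 P where
  toFun e := toL2 P (elemMultipleIntegral W e)
  map_add' e e' := by
    rw [elemMultipleIntegral_add,
      toL2_add (hW.memLp_elemMultipleIntegral e) (hW.memLp_elemMultipleIntegral e')]
  map_smul' c e := by
    rw [elemMultipleIntegral_smul, toL2_const_smul c (hW.memLp_elemMultipleIntegral e),
      RingHom.id_apply]

theorem integral_elemMultipleIntegral_sq [IsProbabilityMeasure P] (hW : IsBrownianSheet W P)
    (e : DisjointRects d q →₀ ℝ) :
    ∫ ω, elemMultipleIntegral W e ω * elemMultipleIntegral W e ω ∂P =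
      ∑ σ : Equiv.Perm (Fin q), ∫ y, elemKernel e (permVars σ y) * elemKernel e y := by
  -- Under `permVars σ` the factor `A_j` is evaluated at `y (σ j)`, so it is `A_{σ⁻¹ k}` that meets
  -- `B_k`. The sum over permutations is therefore reindexed by inversion below.
  have h1 : ∀ (A B : DisjointRects d q) (σ : Equiv.Perm (Fin q)),
      ∏ k, ∫ u, (A.rect (σ.symm k)).toSet.indicator (fun _ => (1 : ℝ)) u *
        (B.rect k).toSet.indicator (fun _ => (1 : ℝ)) u =
      ∫ y : Fin q → Fin d → ℝ,
        (∏ j, (A.rect j).toSet.indicator (fun _ => (1 : ℝ)) (permVars σ y j)) *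
        ∏ k, (B.rect k).toSet.indicator (fun _ => (1 : ℝ)) (y k) := fun A B σ => by
    rw [← integral_fintype_prod_volume_eq_prod (f := fun k u =>
      (A.rect (σ.symm k)).toSet.indicator (fun _ => (1 : ℝ)) u *
        (B.rect k).toSet.indicator (fun _ => (1 : ℝ)) u)]
    congr 1 with y
    rw [Finset.prod_mul_distrib, ← Equiv.prod_comp σ]
    simp [permVars]
  have hi : ∀ (A B : DisjointRects d q), Integrable (fun ω =>
      (∏ j, (A.rect j).increment fun t => W t ω) * ∏ k, (B.rect k).increment fun t => W t ω) P :=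
    fun A B => (hW.memLp_prod_increment A.rect).integrable_mul (hW.memLp_prod_increment B.rect)
  have hi' : ∀ (A B : DisjointRects d q) (σ : Equiv.Perm (Fin q)),
      Integrable (fun y : Fin q → Fin d → ℝ =>
        (∏ j, (A.rect j).toSet.indicator (fun _ => (1 : ℝ)) (permVars σ y j)) *
        ∏ k, (B.rect k).toSet.indicator (fun _ => (1 : ℝ)) (y k)) := fun A B σ =>
    ((memLp_prod_indicator A.rect).comp_measurePreserving
      (measurePreserving_permVars σ)).integrable_mul (memLp_prod_indicator B.rect)
  simp only [elemMultipleIntegral, elemKernel, Finsupp.sum, Finset.sum_mul_sum, mul_mul_mul_comm]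
  rw [integral_finsetSum _ fun A _ => integrable_finsetSum _ fun B _ => (hi A B).const_mul _]
  have e2 : ∀ σ : Equiv.Perm (Fin q), (∫ y : Fin q → Fin d → ℝ, ∑ A ∈ e.support, ∑ B ∈ e.support,
      e A * e B * ((∏ j, (A.rect j).toSet.indicator (fun _ => (1 : ℝ)) (permVars σ y j)) *
        ∏ k, (B.rect k).toSet.indicator (fun _ => (1 : ℝ)) (y k))) =
      ∑ A ∈ e.support, ∑ B ∈ e.support, e A * e B * ∫ y : Fin q → Fin d → ℝ,
        (∏ j, (A.rect j).toSet.indicator (fun _ => (1 : ℝ)) (permVars σ y j)) *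
        ∏ k, (B.rect k).toSet.indicator (fun _ => (1 : ℝ)) (y k) := fun σ => by
    rw [integral_finsetSum _ fun A _ => integrable_finsetSum _ fun B _ => (hi' A B σ).const_mul _]
    refine Finset.sum_congr rfl fun A _ => ?_
    rw [integral_finsetSum _ fun B _ => (hi' A B σ).const_mul _]
    simp only [integral_const_mul]
  simp_rw [e2]
  rw [Finset.sum_comm]
  refine Finset.sum_congr rfl fun A _ => ?_
  rw [Finset.sum_comm, integral_finsetSum _ fun B _ => (hi A B).const_mul _]
  refine Finset.sum_congr rfl fun B _ => ?_
  rw [integral_const_mul, hW.integral_prod_increment_mul, ← Finset.mul_sum,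
    ← Equiv.sum_comp (Equiv.inv (Equiv.Perm (Fin q)))]
  simp only [Equiv.inv_apply, ← h1]
  rfl

theorem norm_elemMultipleIntegralL2_sq [IsProbabilityMeasure P] (hW : IsBrownianSheet W P)
    (e : DisjointRects d q →₀ ℝ) :
    ‖hW.elemMultipleIntegralL2 q e‖ ^ 2 =
      ∑ σ : Equiv.Perm (Fin q), inner ℝ (permL2 d σ (elemKernelL2 d q e)) (elemKernelL2 d q e) := by
  have h : ‖hW.elemMultipleIntegralL2 q e‖ ^ 2 = _ :=
    norm_toL2_sq (hW.memLp_elemMultipleIntegral e)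
  rw [h]
  simp only [sq]
  rw [hW.integral_elemMultipleIntegral_sq]
  refine Finset.sum_congr rfl fun σ _ => ?_
  change _ = inner ℝ (permL2 d σ (toL2 volume (elemKernel e))) (toL2 volume (elemKernel e))
  rw [permL2_toL2 σ (memLp_elemKernel e), inner_toL2 ((memLp_elemKernel e).comp_measurePreserving
    (measurePreserving_permVars σ)) (memLp_elemKernel e)]
  rfl

/-- Cauchy–Schwarz for each of the `q!` permutations. The bound needs no symmetry, so the integral
extends to all of `L²`. -/
theorem norm_elemMultipleIntegralL2_le [IsProbabilityMeasure P] (hW : IsBrownianSheet W P)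
    (e : DisjointRects d q →₀ ℝ) :
    ‖hW.elemMultipleIntegralL2 q e‖ ≤ √(q.factorial : ℝ) * ‖elemKernelL2 d q e‖ := by
  rw [← abs_of_nonneg (norm_nonneg (hW.elemMultipleIntegralL2 q e)),
    ← abs_of_nonneg (mul_nonneg (Real.sqrt_nonneg _) (norm_nonneg (elemKernelL2 d q e))),
    ← sq_le_sq, mul_pow, Real.sq_sqrt (by positivity), hW.norm_elemMultipleIntegralL2_sq]
  calc _ ≤ ∑ _σ : Equiv.Perm (Fin q), ‖elemKernelL2 d q e‖ ^ 2 := by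
        refine Finset.sum_le_sum fun σ _ => (real_inner_le_norm _ _).trans ?_
        rw [LinearIsometry.norm_map, sq]
    _ = _ := by
        rw [Finset.sum_const, Finset.card_univ, Fintype.card_perm, Fintype.card_fin, nsmul_eq_mul]

end IsBrownianSheet

/-! ### Density of the elementary kernels -/

/-- Each diagonal is the kernel of `y ↦ y j - y k`, a proper subspace because `d ≥ 1`, hence a null
set. -/
theorem ae_injective (hd : 1 ≤ d) :
    ∀ᵐ y : Fin q → Fin d → ℝ, ∀ j k, j ≠ k → y j ≠ y k := by
  rw [ae_all_iff]; intro j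
  rw [ae_all_iff]; intro k
  by_cases hjk : j = k
  · exact ae_of_all _ fun y h => absurd hjk h
  let L : (Fin q → Fin d → ℝ) →ₗ[ℝ] (Fin d → ℝ) :=
    LinearMap.proj (R := ℝ) (φ := fun _ : Fin q => Fin d → ℝ) j -
    LinearMap.proj (R := ℝ) (φ := fun _ : Fin q => Fin d → ℝ) k
  have hL : LinearMap.ker L ≠ ⊤ := by
    intro h
    have h1 : (Pi.single j 1 : Fin q → Fin d → ℝ) ∈ LinearMap.ker L := by rw [h]; trivial
    have h2 := congrFun (LinearMap.mem_ker.1 h1) ⟨0, hd⟩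
    simp [L, Ne.symm hjk] at h2
  have h0 := Measure.addHaar_submodule (volume : Measure (Fin q → Fin d → ℝ)) _ hL
  have h3 : ∀ᵐ y : Fin q → Fin d → ℝ, y ∉ (LinearMap.ker L : Set _) :=
    measure_eq_zero_iff_ae_notMem.1 h0
  filter_upwards [h3] with y hy _ h
  exact hy (by simp [L, h])

/-- The cube with center `x` and half side length `r`. -/
def cube (x : Fin d → ℝ) {r : ℝ} (hr : 0 < r) : Rect d where
  lower i := x i - r
  upper i := x i + r
  lower_lt_upper i := by linarith

theorem cube_toSet_ae_eq (x : Fin d → ℝ) {r : ℝ} (hr : 0 < r) :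
    (cube x hr).toSet =ᵐ[volume] Metric.closedBall x r := by
  have : (cube x hr).toSet = Set.univ.pi fun i => Set.Ioc (x i - r) (x i + r) := by
    ext u; simp [Rect.toSet, cube]
  rw [this, closedBall_pi _ hr.le]
  refine Measure.ae_eq_set_pi fun i _ => ?_
  rw [Real.closedBall_eq_Icc]
  exact Ioc_ae_eq_Icc

theorem eventually_disjoint_cube {x x' : Fin d → ℝ} (h : x ≠ x') :
    ∀ᶠ r in 𝓝[>] (0 : ℝ), ∀ hr : 0 < r, Disjoint (cube x hr).toSet (cube x' hr).toSet := by
  obtain ⟨i, hi⟩ := Function.ne_iff.1 h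
  have hpos : 0 < |x i - x' i| / 2 := half_pos (abs_pos.2 (sub_ne_zero.2 hi))
  filter_upwards [mem_nhdsWithin_of_mem_nhds (Iio_mem_nhds hpos)] with r hr hr0
  rw [Set.disjoint_left]
  intro u hu hu'
  have h1 := hu i
  have h2 := hu' i
  simp only [cube] at h1 h2
  have h3 : |x i - x' i| < 2 * r := by
    rw [abs_lt]; constructor <;> linarith
  have : r < |x i - x' i| / 2 := hr
  linarith

/-- Lebesgue differentiation in the sup metric, whose balls are products of cubes. Around a point
off the diagonals, small cubes are pairwise disjoint, so the averages over small balls vanish by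
`h`. -/
theorem eq_zero_of_forall_setIntegral_eq_zero (hd : 1 ≤ d) {g : (Fin q → Fin d → ℝ) → ℝ}
    (hg : LocallyIntegrable g)
    (h : ∀ A : DisjointRects d q, ∫ y in Set.univ.pi fun j => (A.rect j).toSet, g y = 0) :
    g =ᵐ[volume] 0 := by
  filter_upwards [IsUnifLocDoublingMeasure.ae_tendsto_average volume hg 1, ae_injective hd]
    with y hy hinj
  have hlim := hy (l := 𝓝[>] (0 : ℝ)) (fun _ => y) id tendsto_id (by
    filter_upwards [self_mem_nhdsWithin] with r hr
    exact Metric.mem_closedBall_self (by simpa using (Set.mem_Ioi.1 hr).le))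
  refine tendsto_nhds_unique_of_eventuallyEq hlim tendsto_const_nhds ?_
  have hdis : ∀ᶠ r in 𝓝[>] (0 : ℝ), ∀ j k, j ≠ k → ∀ hr : 0 < r,
      Disjoint (cube (y j) hr).toSet (cube (y k) hr).toSet := by
    rw [eventually_all]; intro j
    rw [eventually_all]; intro k
    by_cases hjk : j = k
    · exact Eventually.of_forall fun r h => absurd hjk h
    · exact (eventually_disjoint_cube (hinj j k hjk)).mono fun r hr _ => hr
  filter_upwards [hdis, self_mem_nhdsWithin] with r hr hr0
  have hr0' : 0 < r := hr0
  have hA := h ⟨fun j => cube (y j) hr0', fun j k hjk => hr j k hjk hr0'⟩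
  have hae : (Set.univ.pi fun j => (cube (y j) hr0').toSet) =ᵐ[volume] Metric.closedBall y r := by
    rw [closedBall_pi _ hr0'.le]
    exact Measure.ae_eq_set_pi fun j _ => cube_toSet_ae_eq (y j) hr0'
  rw [setIntegral_congr_set hae] at hA
  rw [id, setAverage_eq, hA, smul_zero]
  rfl

/-- A function orthogonal to every elementary kernel has zero integral over every product of
disjoint rectangles, so it vanishes. -/
theorem denseRange_elemKernelL2 (hd : 1 ≤ d) : DenseRange (elemKernelL2 d q) := by
  rw [DenseRange, ← LinearMap.coe_range, Submodule.dense_iff_topologicalClosure_eq_top,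
    Submodule.topologicalClosure_eq_top_iff, Submodule.eq_bot_iff]
  intro g hg
  have hg' : MemLp g 2 volume := Lp.memLp g
  have hgt : toL2 volume g = g := by rw [toL2_eq hg', Lp.toLp_coeFn]
  rw [Lp.eq_zero_iff_ae_eq_zero]
  refine eq_zero_of_forall_setIntegral_eq_zero hd (hg'.locallyIntegrable (by norm_num)) fun A => ?_
  have h1 := (Submodule.mem_orthogonal _ _).1 hg _ ⟨Finsupp.single A 1, rfl⟩
  rw [← hgt] at h1
  have h2 : inner ℝ (toL2 volume (elemKernel (Finsupp.single A (1 : ℝ)))) (toL2 volume g) = 0 := h1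
  rw [inner_toL2 (memLp_elemKernel _) hg'] at h2
  rw [← h2, ← integral_indicator
    (MeasurableSet.univ_pi fun j => (A.rect j).measurableSet_toSet)]
  congr 1 with y
  simp only [elemKernel, zero_mul, Finsupp.sum_single_index, one_mul]
  by_cases hy : ∀ j, y j ∈ (A.rect j).toSet
  · rw [Set.indicator_of_mem (by simpa using hy), Finset.prod_eq_one, one_mul]
    exact fun j _ => Set.indicator_of_mem (hy j) _
  · rw [Set.indicator_of_notMem (by simpa using hy)]
    push Not at hy
    obtain ⟨j, hj⟩ := hy
    rw [Finset.prod_eq_zero (Finset.mem_univ j) (Set.indicator_of_notMem hj _), zero_mul]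

/-! ### The multiple integral as a continuous linear map -/

namespace IsBrownianSheet

variable {W : (Fin d → ℝ) → Ω → ℝ} [IsProbabilityMeasure P]

/-- The multiple Wiener–Itô integral on `L²`. -/
def multipleIntegralL2 (hW : IsBrownianSheet W P) (q : ℕ) :
    Lp ℝ 2 (volume : Measure (Fin q → Fin d → ℝ)) →L[ℝ] Lp ℝ 2 P :=
  (hW.elemMultipleIntegralL2 q).extendOfNorm (elemKernelL2 d q)

theorem multipleIntegralL2_elemKernelL2 (hW : IsBrownianSheet W P) (hd : 1 ≤ d)
    (e : DisjointRects d q →₀ ℝ) :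
    hW.multipleIntegralL2 q (elemKernelL2 d q e) = hW.elemMultipleIntegralL2 q e :=
  LinearMap.extendOfNorm_eq (denseRange_elemKernelL2 hd) ⟨_, hW.norm_elemMultipleIntegralL2_le⟩ e

/-- Density makes the `comap` filter nontrivial, so the limit is unique, and the continuous
extension supplies it. -/
theorem multipleIntegral_eq (hW : IsBrownianSheet W P) (hd : 1 ≤ d)
    (g : (Fin q → Fin d → ℝ) → ℝ) :
    multipleIntegral W P g = hW.multipleIntegralL2 q (toL2 volume g) := by
  have hne : (comap (elemKernelL2 d q) (𝓝 (toL2 volume g))).NeBot :=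
    comap_neBot fun t ht => by
      obtain ⟨_, hx, a, rfl⟩ := mem_closure_iff_nhds.1
        (denseRange_elemKernelL2 hd (toL2 volume g)) t ht
      exact ⟨a, hx⟩
  have : (comap (fun e : DisjointRects d q →₀ ℝ => toL2 volume (elemKernel e))
      (𝓝 (toL2 volume g))).NeBot := hne
  refine Tendsto.limUnder_eq ?_
  have h := ((hW.multipleIntegralL2 q).continuous.tendsto (toL2 volume g)).comp
    (tendsto_comap (f := elemKernelL2 d q))
  exact h.congr fun e => hW.multipleIntegralL2_elemKernelL2 hd e

/-- Both sides are continuous in `g` and agree on the dense set of elementary kernels. -/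
theorem norm_multipleIntegralL2_sq (hW : IsBrownianSheet W P) (hd : 1 ≤ d)
    (g : Lp ℝ 2 (volume : Measure (Fin q → Fin d → ℝ))) :
    ‖hW.multipleIntegralL2 q g‖ ^ 2 = ∑ σ : Equiv.Perm (Fin q), inner ℝ (permL2 d σ g) g := by
  refine (denseRange_elemKernelL2 hd).induction_on g (isClosed_eq (by fun_prop) ?_) fun e => ?_
  · exact continuous_finsetSum _ fun σ _ => (permL2 d σ).continuous.inner continuous_id
  · rw [hW.multipleIntegralL2_elemKernelL2 hd, hW.norm_elemMultipleIntegralL2_sq]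

/-- The isometry property of the multiple integral on symmetric kernels. -/
theorem norm_multipleIntegralL2_toL2_sq (hW : IsBrownianSheet W P) (hd : 1 ≤ d)
    {g : (Fin q → Fin d → ℝ) → ℝ} (hg : MemLp g 2 volume) (hsymm : ∀ σ y, g (permVars σ y) = g y) :
    ‖hW.multipleIntegralL2 q (toL2 volume g)‖ ^ 2 = (q.factorial : ℝ) * ∫ y, g y ^ 2 := by
  have h : ∀ σ, g ∘ permVars σ = g := fun σ => funext (hsymm σ)
  rw [hW.norm_multipleIntegralL2_sq hd]
  simp_rw [permL2_toL2 _ hg, h, real_inner_self_eq_norm_sq, norm_toL2_sq hg]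
  rw [Finset.sum_const, Finset.card_univ, Fintype.card_perm, Fintype.card_fin, nsmul_eq_mul]

end IsBrownianSheet

end

section

variable {d q : ℕ} {H : Fin d → ℝ} {Ω : Type*} [MeasurableSpace Ω] {P : Measure Ω}

/-! ### The Wiener integral with respect to the Hermite sheet -/

theorem J_permVars (f : (Fin d → ℝ) → ℝ) (σ : Equiv.Perm (Fin q)) (y : Fin q → Fin d → ℝ) :
    J H q f (permVars σ y) = J H q f y := by
  have : ∀ u, hermiteKernel H q u (permVars σ y) = hermiteKernel H q u y := fun u =>
    Equiv.prod_comp σ fun j => ∏ i, (max (u i - y j i) 0) ^ (-(1 / 2 + (1 - H i) / q) : ℝ)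
  simp only [J, this]

/-- The operator `J` as a linear map from the space of integrands to `L²`. -/
def JL2 (H : Fin d → ℝ) (q : ℕ) :
    hSpace H q →ₗ[ℝ] Lp ℝ 2 (volume : Measure (Fin q → Fin d → ℝ)) where
  toFun f := toL2 volume (J H q f)
  map_add' f g := by
    rw [← toL2_add f.2.2.2 g.2.2.2]
    refine toL2_congr (f + g).2.2.2 ?_
    filter_upwards [f.2.2.1, g.2.2.1] with y h1 h2
    simp only [J, Submodule.coe_add, Pi.add_apply, add_mul]
    rw [integral_add h1 h2, mul_add]
  map_smul' c f := by
    rw [RingHom.id_apply, ← toL2_const_smul c f.2.2.2]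
    congr 1
    funext y
    simp only [J, Submodule.coe_smul, Pi.smul_apply, smul_eq_mul, mul_assoc]
    rw [integral_const_mul]
    ring

/-- The oriented indicator of a rectangle as an integrand. -/
def orientedIndicatorH (hq : 1 ≤ q) (hH : ∀ i, 1 / 2 < H i ∧ H i < 1) (t : Fin d → ℝ) :
    hSpace H q :=
  ⟨orientedIndicator t, (mem_hSpace_of_integrable hq hH
    (isBoundedSupported_orientedIndicator t).1.aestronglyMeasurable
    ((isBoundedSupported_orientedIndicator t).integrable hH)).1⟩

/-- The sum is formed inside `hSpace`, so that linear maps on that space can be applied to it term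
by term. -/
theorem elemFun_eq_sum (hq : 1 ≤ q) (hH : ∀ i, 1 / 2 < H i ∧ H i < 1) (e : Rect d →₀ ℝ) :
    elemFun e = (∑ R ∈ e.support, e R • ∑ r, cornerSign r •
      orientedIndicatorH hq hH (R.corner r) : hSpace H q) := by
  funext u
  simp only [elemFun, Finsupp.sum, AddSubmonoidClass.coe_finsetSum, Submodule.coe_smul,
    Finset.sum_apply, Pi.smul_apply, smul_eq_mul]
  refine Finset.sum_congr rfl fun R _ => ?_
  rw [← R.increment_orientedIndicator, R.increment_eq]
  rfl

theorem sum_const_mul_ae_eq {ι : Type*} (s : Finset ι) (c : ι → ℝ) {X : ι → Ω → ℝ}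
    {G : ι → Lp ℝ 2 P} (h : ∀ i, X i =ᵐ[P] G i) :
    (fun ω => ∑ i ∈ s, c i * X i ω) =ᵐ[P] (∑ i ∈ s, c i • G i : Lp ℝ 2 P) := by
  induction s using Finset.cons_induction with
  | empty =>
    simp only [Finset.sum_empty]
    exact (Lp.coeFn_zero ℝ 2 P).symm
  | cons i s hi ih =>
    simp only [Finset.sum_cons]
    filter_upwards [h i, ih, Lp.coeFn_add (c i • G i) (∑ i ∈ s, c i • G i),
      Lp.coeFn_smul (c i) (G i)] with ω h1 h2 h3 h4
    rw [h3, Pi.add_apply, h4, h2, Pi.smul_apply, h1, smul_eq_mul]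

variable {W : (Fin d → ℝ) → Ω → ℝ}

/-- The extension of the Wiener integral with respect to the Hermite sheet to all integrands. -/
def IsBrownianSheet.wienerIntegral [IsProbabilityMeasure P] (hW : IsBrownianSheet W P)
    (H : Fin d → ℝ) (q : ℕ) : hSpace H q →ₗ[ℝ] Lp ℝ 2 P :=
  (hW.multipleIntegralL2 q).toLinearMap ∘ₗ JL2 H q

theorem IsBrownianSheet.wienerIntegral_eq [IsProbabilityMeasure P] (hW : IsBrownianSheet W P)
    (hd : 1 ≤ d) (f : hSpace H q) :
    hW.wienerIntegral H q f = multipleIntegral W P (J H q f) :=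
  (hW.multipleIntegral_eq hd _).symm

theorem IsBrownianSheet.norm_wienerIntegral_sq [IsProbabilityMeasure P] (hW : IsBrownianSheet W P)
    (hd : 1 ≤ d) (f : hSpace H q) : ‖hW.wienerIntegral H q f‖ ^ 2 = hNormSq H q f :=
  hW.norm_multipleIntegralL2_toL2_sq hd f.2.2.2 fun σ y => J_permVars _ σ y

theorem IsHermiteSheet.elemIntegral_ae_eq [IsProbabilityMeasure P] {Z : (Fin d → ℝ) → Ω → ℝ}
    (hZ : IsHermiteSheet H q W P Z) (hW : IsBrownianSheet W P) (hd : 1 ≤ d) (hq : 1 ≤ q)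
    (hH : ∀ i, 1 / 2 < H i ∧ H i < 1) (e : Rect d →₀ ℝ) (f : hSpace H q)
    (hf : (f : (Fin d → ℝ) → ℝ) = elemFun e) :
    elemIntegral Z e =ᵐ[P] hW.wienerIntegral H q f := by
  have hf' : f = ∑ R ∈ e.support, e R • ∑ r, cornerSign r •
      orientedIndicatorH hq hH (R.corner r) := Subtype.ext (hf.trans (elemFun_eq_sum hq hH e))
  rw [hf', map_sum]
  simp only [map_smul, map_sum]
  refine sum_const_mul_ae_eq _ _ fun R => sum_const_mul_ae_eq _ _ fun r => ?_
  rw [hW.wienerIntegral_eq hd]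
  exact hZ _

end

end HermiteSheet

end

theorem mainTheorem2 {d q : ℕ} (hd : 1 ≤ d) (hq : 1 ≤ q)
    (H : Fin d → ℝ) (hH : ∀ i, 1 / 2 < H i ∧ H i < 1)
    {Ω : Type*} [MeasurableSpace Ω] (P : Measure Ω) [IsProbabilityMeasure P]
    (W : (Fin d → ℝ) → Ω → ℝ) (hW : HermiteSheet.IsBrownianSheet W P)
    (Z : (Fin d → ℝ) → Ω → ℝ) (hZ : HermiteSheet.IsHermiteSheet H q W P Z) :
    -- isometry on elementary functions, and representation in the `q`-th chaos
    (∀ e : HermiteSheet.Rect d →₀ ℝ,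
      HermiteSheet.elemFun e ∈ HermiteSheet.hSpace H q ∧
      MemLp (HermiteSheet.elemIntegral Z e) 2 P ∧
      ∫ ω, HermiteSheet.elemIntegral Z e ω ^ 2 ∂P
        = HermiteSheet.hNormSq H q (HermiteSheet.elemFun e) ∧
      Integrable (fun p : (Fin d → ℝ) × (Fin d → ℝ) =>
        HermiteSheet.elemFun e p.1 * HermiteSheet.elemFun e p.2 *
          HermiteSheet.rieszKernel H p.1 p.2) ∧
      HermiteSheet.hNormSq H q (HermiteSheet.elemFun e)
        = HermiteSheet.doubleIntegral H (HermiteSheet.elemFun e) ∧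
      HermiteSheet.elemIntegral Z e =ᵐ[P]
        HermiteSheet.multipleIntegral W P (HermiteSheet.J H q (HermiteSheet.elemFun e))) ∧
    -- extension to an isometry from `ℋ` into `L²(Ω)`
    (∃ Φ : HermiteSheet.hSpace H q →ₗ[ℝ] Lp ℝ 2 P,
      (∀ f : HermiteSheet.hSpace H q, ‖Φ f‖ ^ 2 = HermiteSheet.hNormSq H q f) ∧
      (∀ (f : HermiteSheet.hSpace H q) (e : HermiteSheet.Rect d →₀ ℝ),
        (f : (Fin d → ℝ) → ℝ) = HermiteSheet.elemFun e →
          Φ f =ᵐ[P] HermiteSheet.elemIntegral Z e) ∧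
      (∀ f : HermiteSheet.hSpace H q,
        Φ f = HermiteSheet.multipleIntegral W P (HermiteSheet.J H q f))) ∧
    -- the norm of `ℋ` as a double integral, whenever the latter converges absolutely
    (∀ f : (Fin d → ℝ) → ℝ, AEStronglyMeasurable f volume →
      Integrable (fun p : (Fin d → ℝ) × (Fin d → ℝ) =>
        f p.1 * f p.2 * HermiteSheet.rieszKernel H p.1 p.2) →
      f ∈ HermiteSheet.hSpace H q ∧
        HermiteSheet.hNormSq H q f = HermiteSheet.doubleIntegral H f) := by
  have hb := HermiteSheet.isBoundedSupported_elemFun (d := d)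
  have hmem : ∀ e, _ := fun e => HermiteSheet.mem_hSpace_of_integrable hq hH
    (hb e).1.aestronglyMeasurable ((hb e).integrable hH)
  refine ⟨fun e => ?_, ⟨hW.wienerIntegral H q, hW.norm_wienerIntegral_sq hd,
    fun f e hf => (hZ.elemIntegral_ae_eq hW hd hq hH e f hf).symm, hW.wienerIntegral_eq hd⟩,
    fun f hf hi => HermiteSheet.mem_hSpace_of_integrable hq hH hf hi⟩
  have hae := hZ.elemIntegral_ae_eq hW hd hq hH e ⟨HermiteSheet.elemFun e, (hmem e).1⟩ rfl
  -- No measurability of `Z` is assumed; it comes from almost sure equality with an element of `L²`.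
  have hL : MemLp (HermiteSheet.elemIntegral Z e) 2 P := (memLp_congr_ae hae).2 (Lp.memLp _)
  refine ⟨(hmem e).1, hL, ?_, (hb e).integrable hH, (hmem e).2, ?_⟩
  · rw [← HermiteSheet.norm_toL2_sq hL, HermiteSheet.toL2_eq hL, MemLp.toLp_congr hL (Lp.memLp _) hae,
      Lp.toLp_coeFn, hW.norm_wienerIntegral_sq hd]
  · rw [← hW.wienerIntegral_eq hd ⟨HermiteSheet.elemFun e, (hmem e).1⟩]
    exact hae
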